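/- **Setting.** Let $T=(V,E,w)$ be a finite tree of order $n=|V|\ge 2$ with edge weights $w:E\to\mathbb{R}^+$, rooted at a vertex $r$ (the homebase), and let $q\ge 0$ be the invoking cost. For $v\in V$ let $c(v)$ be the list of children of $v$ (in an arbitrary order); a leaf is a vertex without children; $d$ is the weighted distance in $T$. A *strategy* is a finite sequence of moves, starting with no agent in the tree, where each move either invokes a new agent at $r$ or lets one already invoked agent traverse an edge from the vertex that it occupies. A strategy *explores* $T$ if every vertex is visited by at least one agent; agents need not return to $r$. If it uses $k$ agents and the $i$-th agent traverses total distance $d_i$, its cost is $kq+\sum_{i=1}^k d_i$. A strategy that explores $T$ is *cost-optimal* if no strategy that explores $T$ has a smaller cost. **Procedure CostExpl.** It runs SetLabeling at $r$ and then SetStrategy at $r$. *SetLabeling* at $v$ computes a label $\Lambda_v=(k,u_l,u_c)$. If $v$ is a leaf, then $\Lambda_v=(1,v,\mathrm{null})$. Otherwise it first calls itself at every child of $v$, then starts with $k=0$, $d^{\max}=0$ and, for every $u\in c(v)$ in turn, adds $\Lambda_u.k$ to $k$; subtracts $1$ from $k$ if $\Lambda_u.k=1$ and $d(v,\Lambda_u.u_l)\le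 d(r,v)+q$; and, if $d(v,\Lambda_u.u_l)>d^{\max}$, sets $d^{\max}=d(v,\Lambda_u.u_l)$ and $u_c=u$. Finally $\Lambda_v=(\max\{1,k\},\Lambda_{u_c}.u_l,u_c)$. *SetStrategy* at $v$ does nothing if $v$ is a leaf. Otherwise, if $v=r$, it adds the instruction "invoke $\Lambda_r.k$ agents at $r$". Then for every child $u$ of $v$, with $\Lambda_v.u_c$ as the last one, it adds "traverse $(v,u)$ by $\Lambda_u.k$ agents", calls itself at $u$, and, if $u\ne\Lambda_v.u_c$ and $d(v,\Lambda_u.u_l)\le d(r,v)+q$, adds "send an agent back from $\Lambda_u.u_l$ to $v$" (along the path in $T$). An instruction stands for the corresponding sequence of single moves; which of the agents present at its starting vertex perform it, and in which order, is left open. **Theorem.** There is an absolute constant $C$ such that for all $T$ and $q$ as above: 1. the list of instructions returned by CostExpl can be carried out, i.e. it describes at least one sequence of moves; 2. every sequence of moves that it describes is a strategy, explores $T$, and is cost-optimal; 3. CostExpl performs at most $C\,n$ elementary operations, i.e. it runs in $O(n)$ time, where reading or writing a cell of an array indexed by vertices, an arithmetic operation or comparison of numbers, a comparison of vertices, a test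 for the end of a list, and adding one instruction to the output count as one operation each, and allocating such an array counts $n$ operations. The computation of a table of the distances $d(r,v)$, from which the distances in the procedures are obtained by subtraction, is included in the count. -/

import Mathlib

/-! ## Edge-weighted rooted trees -/

/-- A tree with vertex set `V`, positive edge weights and a root (the homebase), given together with
the list of children of every vertex, in an arbitrary order. -/
structure WeightedTree (V : Type) where
  graph : SimpleGraph V
  isTree : graph.IsTree
  weight : Sym2 V → ℝ
  weight_pos : ∀ e ∈ graph.edgeSet, 0 < weight e
  root : V
  children : V → List V
  children_nodup : ∀ v, (children v).Nodup
  mem_children : ∀ v u, u ∈ children v ↔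
    graph.Adj v u ∧ graph.dist root u = graph.dist root v + 1

/-! ## Strategies, exploration and cost -/

/-- A single move. Agents are numbered `0, 1, 2, …` in the order in which they are invoked. -/
inductive Move (V : Type) where
  /-- a new agent is invoked in the homebase -/
  | invoke : Move V
  /-- agent `i` traverses an edge from `u` to `v` -/
  | traverse (i : ℕ) (u v : V) : Move V

namespace WeightedTree

variable {V : Type} (T : WeightedTree V)

/-- The positions of the agents after a move; entry `i` of the list is the position of agent `i`. -/
def after (pos : List V) : Move V → List V
  | .invoke => pos ++ [T.root]
  | .traverse i _ v => pos.set i v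

/-- A move is legal if it is an invocation, or if the moving agent has been invoked and stands at
one end of the edge that it traverses. -/
def LegalMove (pos : List V) : Move V → Prop
  | .invoke => True
  | .traverse i u v => pos[i]? = some u ∧ T.graph.Adj u v

/-- Every move of the sequence is legal when the moves are made one after another. -/
def LegalFrom : List V → List (Move V) → Prop
  | _, [] => True
  | pos, m :: S => T.LegalMove pos m ∧ LegalFrom (T.after pos m) S

/-- A strategy is a sequence of legal moves; at the beginning no agent has been invoked. -/
def IsStrategy (S : List (Move V)) : Prop := T.LegalFrom [] S

/-- The vertex at which the moving (or the invoked) agent stands after a move. -/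
def reached : Move V → V
  | .invoke => T.root
  | .traverse _ _ v => v

/-- Every vertex is visited by at least one agent. -/
def Explores (S : List (Move V)) : Prop := ∀ v, ∃ m ∈ S, T.reached m = v

/-- The contribution of a move to the distance traversed by agent `i`. -/
def moveLength (i : ℕ) : Move V → ℝ
  | .invoke => 0
  | .traverse j u v => if j = i then T.weight s(u, v) else 0

/-- The distance `d_i` traversed by agent `i`. -/
def agentDistance (S : List (Move V)) (i : ℕ) : ℝ := (S.map (T.moveLength i)).sum

end WeightedTree

/-- The contribution of a move to the number of agents. -/
def Move.invocations {V : Type} : Move V → ℕ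
  | .invoke => 1
  | .traverse _ _ _ => 0

/-- The number `k` of agents used by a strategy. -/
def numAgents {V : Type} (S : List (Move V)) : ℕ := (S.map Move.invocations).sum

namespace WeightedTree

variable {V : Type} (T : WeightedTree V)

/-- The cost `k q + ∑ d_i` of a strategy, for the invoking cost `q`. -/
noncomputable def cost (q : ℝ) (S : List (Move V)) : ℝ :=
  (numAgents S : ℝ) * q + ∑ i ∈ Finset.range (numAgents S), T.agentDistance S i

/-- `S` is a strategy that explores the tree, at the least cost among all such strategies. -/
def IsCostOptimal (q : ℝ) (S : List (Move V)) : Prop :=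
  T.IsStrategy S ∧ T.Explores S ∧
    ∀ S' : List (Move V), T.IsStrategy S' → T.Explores S' → T.cost q S ≤ T.cost q S'

end WeightedTree

/-! ## Sequences of moves as they are written by the procedures -/

/-- The lines `Add a move / a sequence of moves to S` of the procedures. -/
inductive Instr (V : Type) where
  /-- invoke `m` agents in the homebase -/
  | invoke (m : ℕ) : Instr V
  /-- traverse the edge from `u` to `v` by `m` agents -/
  | traverse (u v : V) (m : ℕ) : Instr V
  /-- send an agent back from `x` to `v` -/
  | sendBack (x v : V) : Instr V

namespace WeightedTree

variable {V : Type} (T : WeightedTree V)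

/-- The move sequences described by one instruction when the agents are in the positions `pos`.
Which of the agents present at the starting vertex perform it, and in which order, is left open. -/
def ExpandsInstr (pos : List V) : Instr V → List (Move V) → Prop
  | .invoke m, S => S = List.replicate m Move.invoke
  | .traverse u v m, S => ∃ A : List ℕ, A.Nodup ∧ A.length = m ∧ (∀ i ∈ A, pos[i]? = some u) ∧
      S = A.map fun i => Move.traverse i u v
  | .sendBack x v, S => ∃ (i : ℕ) (p : T.graph.Walk x v), pos[i]? = some x ∧ p.IsPath ∧
      S = p.darts.map fun d => Move.traverse i d.fst d.snd

/-- The move sequences described by a list of instructions, started from the positions `pos`. -/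
def Expands : List V → List (Instr V) → List (Move V) → Prop
  | _, [], S => S = []
  | pos, I :: L, S => ∃ S₁ S₂, S = S₁ ++ S₂ ∧ T.ExpandsInstr pos I S₁ ∧
      Expands (S₁.foldl T.after pos) L S₂

end WeightedTree

/-! ## Computations with a step count (unit-cost random access machine over the reals) -/

/-- The result of a computation together with the number of elementary operations performed. -/
structure Timed (α : Type) where
  val : α
  steps : ℕ

namespace Timed

/-- Running computations one after another adds up their numbers of steps. -/
instance : Monad Timed where
  pure a := ⟨a, 0⟩
  bind x f := ⟨(f x.val).val, x.steps + (f x.val).steps⟩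

/-- One elementary operation with result `x`: reading or writing one array cell, one arithmetic
operation or comparison of numbers, one comparison of vertices, one test for the empty list, or
adding one instruction to the output. -/
def op {α : Type} (x : α) : Timed α := ⟨x, 1⟩

/-- Allocation of an array indexed by the vertices, at one step per cell. -/
def alloc (V : Type) [Fintype V] {α : Type} (x : α) : Timed (V → α) := ⟨fun _ => x, Fintype.card V⟩

/-- The loop `for all a ∈ l`, with loop state `s` and body `f`. Every test of the loop for the
end of the list is one step. -/
def forEach {α σ : Type} : (l : List α) → (s : σ) → ((a : α) → a ∈ l → σ → Timed σ) → Timed σ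
  | [], s, _ => op s
  | a :: l, s, f => do
      let s ← op s
      let s ← f a List.mem_cons_self s
      forEach l s fun b hb => f b (List.mem_cons_of_mem a hb)

end Timed

/-! ## The procedures -/

/-- The label `(k, u_l, u_c)` of a vertex; `none` stands for `null`. -/
structure Label (V : Type) where
  k : ℕ
  ul : V
  uc : Option V

namespace WeightedTree

open Timed

variable {V : Type} (T : WeightedTree V)

/-- Children are farther from the root, and all vertices are less than `|V|` edges away. -/
theorem measure_lt [Fintype V] {v u : V} (h : u ∈ T.children v) :
    Fintype.card V - T.graph.dist T.root u < Fintype.card V - T.graph.dist T.root v := by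
  have h1 := ((T.mem_children v u).1 h).2
  obtain ⟨p, hp, hl⟩ := T.isTree.connected.exists_path_of_dist T.root u
  have h2 := hp.length_lt
  omega

/-- Given that `D v` holds the distance `d(r, v)`, stores `d(r, x)` in `D x` for all `x` below `v`. -/
noncomputable def setDistances [Fintype V] [DecidableEq V] (v : V) (D : V → ℝ) :
    Timed (V → ℝ) :=
  forEach (T.children v) D fun u _hu D => do
    let dv ← op (D v)
    let w ← op (T.weight s(v, u))
    let du ← op (dv + w)
    let D ← op (Function.update D u du)
    setDistances u D
termination_by Fintype.card V - T.graph.dist T.root v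
decreasing_by exact T.measure_lt _hu

/-- The procedure `SetLabeling` for the vertex `v`. The array `D` holds the distances from the root,
so that `d(v, x) = D x - D v` for every vertex `x` below `v`. -/
noncomputable def setLabeling [Fintype V] [DecidableEq V] (q : ℝ) (D : V → ℝ)
    (v : V) (Λ : V → Label V) : Timed (V → Label V) := do
  let isLeaf ← op (T.children v).isEmpty
  if isLeaf then
    op (Function.update Λ v ⟨1, v, none⟩)
  else
    let Λ ← forEach (T.children v) Λ fun u _hu Λ => setLabeling q D u Λ
    let dv ← op (D v)
    let dr ← op (dv + q)
    let (k, _, uc) ← forEach (T.children v) ((0, 0, none) : ℕ × ℝ × Option V)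
      fun u _ (k, dmax, uc) => do
        let lab ← op (Λ u)
        let k ← op (k + lab.k)
        let dl ← op (D lab.ul)
        let d ← op (dl - dv)
        let single ← op (decide (lab.k = 1))
        let near ← op (decide (d ≤ dr))
        let k ← op (if single && near then k - 1 else k)
        let farther ← op (decide (dmax < d))
        if farther then op (k, d, some u) else op (k, dmax, uc)
    let k ← op (max 1 k)
    match uc with
    | none => pure Λ
    | some u => do
        let lab ← op (Λ u)
        op (Function.update Λ v ⟨k, lab.ul, some u⟩)
termination_by Fintype.card V - T.graph.dist T.root v
decreasing_by exact T.measure_lt _hu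

/-- The procedure `SetStrategy` for the vertex `v`. The children other than `Λ_v.u_c` are handled in
the first pass over the list of children, and `Λ_v.u_c` in the second one. -/
noncomputable def setStrategy [Fintype V] [DecidableEq V] (q : ℝ) (D : V → ℝ)
    (Λ : V → Label V) (v : V) (S : List (Instr V)) :
    Timed (List (Instr V)) := do
  let isLeaf ← op (T.children v).isEmpty
  if isLeaf then
    pure S
  else
    let lv ← op (Λ v)
    let isRoot ← op (decide (v = T.root))
    let S ← if isRoot then op (S ++ [Instr.invoke lv.k]) else pure S
    let dv ← op (D v)
    let dr ← op (dv + q)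
    forEach [false, true] S fun lastPass _ S =>
      forEach (T.children v) S fun u _hu S => do
        let isLast ← op (decide (lv.uc = some u))
        if isLast = lastPass then
          let lab ← op (Λ u)
          let S ← op (S ++ [Instr.traverse v u lab.k])
          let S ← setStrategy q D Λ u S
          let dl ← op (D lab.ul)
          let d ← op (dl - dv)
          let near ← op (decide (d ≤ dr))
          if near && !isLast then op (S ++ [Instr.sendBack lab.ul v]) else pure S
        else
          pure S
termination_by Fintype.card V - T.graph.dist T.root v
decreasing_by exact T.measure_lt _hu

/-- The procedure `CostExpl`: first the labeling is computed by `SetLabeling`, then the strategy is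
computed from it by `SetStrategy`. The distances from the root, which both procedures use, are
tabulated beforehand, and the time for this is counted. -/
noncomputable def costExpl [Fintype V] [DecidableEq V] (q : ℝ) : Timed (List (Instr V)) := do
  let D ← alloc V (0 : ℝ)
  let D ← T.setDistances T.root D
  let Λ ← alloc V (⟨0, T.root, none⟩ : Label V)
  let Λ ← T.setLabeling q D T.root Λ
  T.setStrategy q D Λ T.root []

end WeightedTree

/-! Every edge joins a vertex `c` to its parent, so a strategy with `k` agents costs `k * q` plus
the sum over `c` of `parentWeight c` times the number of traversals of the edge above `c`
(`cost_eq`, `travel_eq_sum`). If `n c` agents end below `c`, this edge is crossed at least `n c`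
times, and at least twice if `n c = 0`, since the agent that visits `c` has to leave again
(`leastCrossings_le`). The cost is thus bounded below by a function of the final positions alone,
and this function is minimised by a recursion from the leaves to the root.

The recursion compares two prices at a vertex `v`. A fresh agent at `v` costs `depth v + q`. A child
`u` is `Near` if the way back from the deepest vertex below `u` to `v` costs at most that much. A
near child that is not handled last is explored by one agent that returns, so that each edge is used
twice; below any other child the agents stay. `detour` is the resulting price of a child, and
`serve` is the price at `v` when the agents stay below `v`: the detours to all children, plus `depth
v + q - height v` when this is positive. In that case a single agent suffices, and it saves the
return from the deepest vertex.

Lower bound: `serve_le` proves by induction that `serve` does not exceed the bound above, for any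
numbers `n` that can arise; at the root this is `serve_root_le_cost`. Upper bound: every sequence of
moves described by the output costs exactly `serve q T.root`. This is a Hoare-style argument:
`Carries` asserts that the instructions can be carried out and that each way of doing so meets a
postcondition, and `carries_node` leads from `Ready` to `Explored`. Only the numbers of agents at
the vertices enter, so the choices left open do not matter.

The link to the procedures is `val_setLabeling_and_label` together with `program_node`. A near child
always has label `k = 1`, so the two conditions tested by `setLabeling` amount to `Near`, the only
one that `setStrategy` tests. The running time is a constant per vertex and per child, summed over
the tree. -/

set_option linter.unusedSectionVars false

namespace WeightedTree

variable {V : Type} (T : WeightedTree V)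

/-! ## Descendants and depth -/

section Tree

theorem dist_child {v u : V} (h : u ∈ T.children v) :
    T.graph.dist T.root u = T.graph.dist T.root v + 1 := ((T.mem_children v u).1 h).2

theorem adj_child {v u : V} (h : u ∈ T.children v) : T.graph.Adj v u :=
  ((T.mem_children v u).1 h).1

theorem child_ne {v u : V} (h : u ∈ T.children v) : u ≠ v := (T.adj_child h).ne'

theorem child_ne_root {v u : V} (h : u ∈ T.children v) : u ≠ T.root := by
  rintro rfl
  simpa using T.dist_child h

theorem weight_child_pos {v u : V} (h : u ∈ T.children v) : 0 < T.weight s(v, u) :=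
  T.weight_pos _ (T.adj_child h)

/-- Distances from the root to adjacent vertices differ by at most one, and in a tree they are never
equal. -/
theorem child_or_child_of_adj {u v : V} (h : T.graph.Adj u v) :
    v ∈ T.children u ∨ u ∈ T.children v := by
  simp only [T.mem_children, h, h.symm, true_and]
  have h1 := T.isTree.dist_ne_of_adj T.root h
  have h2 := h.diff_dist_adj (u := T.root)
  omega

theorem exists_mem_children {v : V} (h : v ≠ T.root) : ∃ x, v ∈ T.children x := by
  obtain ⟨p, hp⟩ := T.isTree.connected.exists_walk_length_eq_dist T.root v
  have hn : ¬ p.Nil := fun hn => h hn.eq.symm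
  refine ⟨p.penultimate, (T.mem_children _ _).2 ⟨p.adj_penultimate hn, ?_⟩⟩
  have h1 := (p.adj_penultimate hn).diff_dist_adj (u := T.root)
  have h2 : T.graph.dist T.root p.penultimate ≤ p.dropLast.length := SimpleGraph.dist_le _
  have h3 : p.length ≠ 0 := fun h0 => hn (SimpleGraph.Walk.length_eq_zero_iff.1 h0)
  have h4 := p.length_dropLast
  have h5 := T.isTree.dist_ne_of_adj T.root (p.adj_penultimate hn)
  omega

/-- The parent of a vertex is unique. -/
theorem parent_unique {x y u : V} (hx : u ∈ T.children x) (hy : u ∈ T.children y) : x = y := by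
  obtain ⟨p, hp⟩ := T.isTree.connected.exists_walk_length_eq_dist T.root x
  obtain ⟨p', hp'⟩ := T.isTree.connected.exists_walk_length_eq_dist T.root y
  -- Shortest walks through either parent are paths from the root to `u`. The tree has only one such
  -- path, and it has only one penultimate vertex.
  have h1 := (p.concat (T.adj_child hx)).isPath_of_length_eq_dist
    (by rw [SimpleGraph.Walk.length_concat, hp, T.dist_child hx])
  have h2 := (p'.concat (T.adj_child hy)).isPath_of_length_eq_dist
    (by rw [SimpleGraph.Walk.length_concat, hp', T.dist_child hy])
  have h3 := (T.isTree.existsUnique_path T.root u).unique h1 h2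
  have h4 := congrArg SimpleGraph.Walk.penultimate h3
  simpa using h4

/-- The list of the vertices below `v`, with `v` itself. -/
def descendants [Fintype V] (v : V) : List V :=
  v :: (T.children v).attach.flatMap fun u => descendants u.1
termination_by Fintype.card V - T.graph.dist T.root v
decreasing_by exact T.measure_lt u.2

variable [Fintype V]

/-- Induction from the leaves to the root. -/
theorem child_induction {P : V → Prop} (h : ∀ v, (∀ u ∈ T.children v, P u) → P v) (v : V) :
    P v := by
  induction hn : Fintype.card V - T.graph.dist T.root v using Nat.strong_induction_on
    generalizing v with
  | _ n ih =>
    subst hn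
    exact h v fun u hu => ih _ (T.measure_lt hu) u rfl

theorem descendants_eq (v : V) :
    T.descendants v = v :: (T.children v).flatMap T.descendants := by
  rw [descendants]
  simp

theorem descendants_leaf {v : V} (h : T.children v = []) : T.descendants v = [v] := by
  rw [descendants_eq, h]; rfl

theorem mem_descendants {v x : V} :
    x ∈ T.descendants v ↔ x = v ∨ ∃ u ∈ T.children v, x ∈ T.descendants u := by
  rw [descendants_eq]; simp

theorem mem_descendants_self (v : V) : v ∈ T.descendants v := T.mem_descendants.2 (.inl rfl)

theorem mem_descendants_of_child {v u x : V} (hu : u ∈ T.children v)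
    (hx : x ∈ T.descendants u) : x ∈ T.descendants v := T.mem_descendants.2 (.inr ⟨u, hu, hx⟩)

theorem dist_le_of_mem_descendants {v x : V} (h : x ∈ T.descendants v) :
    T.graph.dist T.root v ≤ T.graph.dist T.root x := by
  induction v using T.child_induction with
  | _ v ih =>
    rcases T.mem_descendants.1 h with rfl | ⟨u, hu, hx⟩
    · exact le_rfl
    · have := ih u hu hx
      have := T.dist_child hu
      omega

theorem dist_lt_of_mem_descendants {v x : V} (h : x ∈ T.descendants v) (hne : x ≠ v) :
    T.graph.dist T.root v < T.graph.dist T.root x := by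
  rcases T.mem_descendants.1 h with rfl | ⟨u, hu, hx⟩
  · exact absurd rfl hne
  · have := T.dist_le_of_mem_descendants hx
    have := T.dist_child hu
    omega

theorem not_mem_descendants_child {v u : V} (hu : u ∈ T.children v) : v ∉ T.descendants u := by
  intro h
  have := T.dist_le_of_mem_descendants h
  have := T.dist_child hu
  omega

theorem child_mem_descendants {v x y : V} (h : x ∈ T.descendants v) (hy : y ∈ T.children x) :
    y ∈ T.descendants v := by
  induction v using T.child_induction with
  | _ v ih =>
    rcases T.mem_descendants.1 h with rfl | ⟨u, hu, hx⟩
    · exact T.mem_descendants_of_child hy (T.mem_descendants_self y)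
    · exact T.mem_descendants_of_child hu (ih u hu hx)

theorem parent_mem_descendants {v x y : V} (h : y ∈ T.descendants v) (hne : y ≠ v)
    (hy : y ∈ T.children x) : x ∈ T.descendants v := by
  induction v using T.child_induction with
  | _ v ih =>
    rcases T.mem_descendants.1 h with rfl | ⟨u, hu, hx⟩
    · exact absurd rfl hne
    · by_cases hyu : y = u
      · subst hyu
        rw [T.parent_unique hy hu]
        exact T.mem_descendants_self v
      · exact T.mem_descendants_of_child hu (ih u hu hx hyu)

/-- Climb from `x` to its parent: this stays below both `u` and `u'` until one of them is reached,
and equal distance from the root forces them to be reached together. -/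
theorem eq_of_mem_descendants {u u' x : V} (h : x ∈ T.descendants u) (h' : x ∈ T.descendants u')
    (hd : T.graph.dist T.root u = T.graph.dist T.root u') : u = u' := by
  induction hn : T.graph.dist T.root x using Nat.strong_induction_on generalizing x with
  | _ n ih =>
    by_cases hu : x = u
    · subst hu
      by_contra hne
      have := T.dist_lt_of_mem_descendants h' hne
      omega
    · have hlt := T.dist_lt_of_mem_descendants h hu
      have hu' : x ≠ u' := by rintro rfl; omega
      obtain ⟨y, hy⟩ := T.exists_mem_children (v := x) (by rintro rfl; simp at hlt)
      exact ih _ (by have := T.dist_child hy; omega) (T.parent_mem_descendants h hu hy)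
        (T.parent_mem_descendants h' hu' hy) rfl

theorem eq_of_mem_descendants_children {v u u' x : V} (hu : u ∈ T.children v)
    (hu' : u' ∈ T.children v) (h : x ∈ T.descendants u) (h' : x ∈ T.descendants u') : u = u' :=
  T.eq_of_mem_descendants h h' ((T.dist_child hu).trans (T.dist_child hu').symm)

theorem nodup_descendants (v : V) : (T.descendants v).Nodup := by
  induction v using T.child_induction with
  | _ v ih =>
    rw [descendants_eq, List.nodup_cons, List.nodup_flatMap]
    refine ⟨?_, ih, ?_⟩
    · simp only [List.mem_flatMap, not_exists, not_and]
      exact fun u hu => T.not_mem_descendants_child hu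
    · refine (List.Nodup.pairwise_of_forall_ne (T.children_nodup v) ?_)
      intro a ha b hb hab x hxa hxb
      exact hab (T.eq_of_mem_descendants_children ha hb hxa hxb)

theorem mem_descendants_root (x : V) : x ∈ T.descendants T.root := by
  induction hn : T.graph.dist T.root x using Nat.strong_induction_on generalizing x with
  | _ n ih =>
    by_cases hx : x = T.root
    · exact hx ▸ T.mem_descendants_self _
    · obtain ⟨y, hy⟩ := T.exists_mem_children hx
      exact T.child_mem_descendants (ih _ (by have := T.dist_child hy; omega) y rfl) hy

theorem length_descendants_root_le : (T.descendants T.root).length ≤ Fintype.card V :=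
  (T.nodup_descendants _).length_le_card

theorem length_descendants (v : V) :
    (T.descendants v).length = 1 + ((T.children v).map fun u => (T.descendants u).length).sum := by
  rw [descendants_eq, List.length_cons, List.length_flatMap, add_comm]

/-- The sum of `g` over the vertices below `v`, with `v` itself. -/
def subtreeSum {M : Type} [AddCommMonoid M] (g : V → M) (v : V) : M :=
  ((T.descendants v).map g).sum

theorem subtreeSum_eq {M : Type} [AddCommMonoid M] (g : V → M) (v : V) :
    T.subtreeSum g v = g v + ((T.children v).map (T.subtreeSum g)).sum := by
  unfold subtreeSum
  conv_lhs => rw [descendants_eq, List.map_cons, List.sum_cons, List.map_flatMap,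
    List.flatMap, List.sum_flatten, List.map_map]
  rfl

theorem subtreeSum_root {M : Type} [AddCommMonoid M] (g : V → M) :
    T.subtreeSum g T.root = ∑ x, g x := by
  classical
  unfold subtreeSum
  rw [← List.sum_toFinset _ (T.nodup_descendants _)]
  congr 1
  ext x
  simp [T.mem_descendants_root x]

end Tree

/-! ### Weighted distances from the root. -/

section Depth

open Classical in
/-- The weight of the edge from `v` to its parent; zero at the root. -/
noncomputable def parentWeight (v : V) : ℝ :=
  if h : ∃ x, v ∈ T.children x then T.weight s(h.choose, v) else 0

open Classical in
/-- The weighted distance from the root. -/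
noncomputable def depth (v : V) : ℝ :=
  if h : ∃ x, v ∈ T.children x then depth h.choose + T.weight s(h.choose, v) else 0
termination_by T.graph.dist T.root v
decreasing_by rw [T.dist_child h.choose_spec]; omega

theorem parentWeight_child {v u : V} (h : u ∈ T.children v) :
    T.parentWeight u = T.weight s(v, u) := by
  have hex : ∃ x, u ∈ T.children x := ⟨v, h⟩
  rw [parentWeight, dif_pos hex, T.parent_unique hex.choose_spec h]

theorem parentWeight_root : T.parentWeight T.root = 0 :=
  dif_neg fun ⟨_, h⟩ => T.child_ne_root h rfl

theorem depth_child {v u : V} (h : u ∈ T.children v) :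
    T.depth u = T.depth v + T.parentWeight u := by
  have hex : ∃ x, u ∈ T.children x := ⟨v, h⟩
  rw [T.parentWeight_child h, depth, dif_pos hex, T.parent_unique hex.choose_spec h]

theorem depth_root : T.depth T.root = 0 := by
  rw [depth]
  exact dif_neg fun ⟨_, h⟩ => T.child_ne_root h rfl

theorem parentWeight_nonneg (v : V) : 0 ≤ T.parentWeight v := by
  by_cases h : v = T.root
  · rw [h, parentWeight_root]
  · obtain ⟨x, hx⟩ := T.exists_mem_children h
    rw [T.parentWeight_child hx]
    exact (T.weight_child_pos hx).le

theorem parentWeight_pos {v u : V} (h : u ∈ T.children v) : 0 < T.parentWeight u := by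
  rw [T.parentWeight_child h]
  exact T.weight_child_pos h

theorem depth_le_of_mem_descendants [Fintype V] {v x : V} (h : x ∈ T.descendants v) :
    T.depth v ≤ T.depth x := by
  induction v using T.child_induction with
  | _ v ih =>
    rcases T.mem_descendants.1 h with rfl | ⟨u, hu, hx⟩
    · exact le_rfl
    · have := ih u hu hx
      have := T.depth_child hu
      have := T.parentWeight_nonneg u
      linarith

theorem depth_nonneg [Fintype V] (v : V) : 0 ≤ T.depth v := by
  rw [← T.depth_root]
  exact T.depth_le_of_mem_descendants (T.mem_descendants_root v)

end Depth

end WeightedTree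

/-! ### Values and step counts of timed computations. -/

namespace Timed

@[simp] theorem val_bind {α β : Type} (x : Timed α) (f : α → Timed β) :
    (x >>= f).val = (f x.val).val := rfl

@[simp] theorem steps_bind {α β : Type} (x : Timed α) (f : α → Timed β) :
    (x >>= f).steps = x.steps + (f x.val).steps := rfl

@[simp] theorem val_pure {α : Type} (a : α) : (pure a : Timed α).val = a := rfl

@[simp] theorem steps_pure {α : Type} (a : α) : (pure a : Timed α).steps = 0 := rfl

@[simp] theorem val_op {α : Type} (a : α) : (op a).val = a := rfl

@[simp] theorem steps_op {α : Type} (a : α) : (op a).steps = 1 := rfl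

@[simp high] theorem val_op_bind {α β : Type} (a : α) (f : α → Timed β) :
    (op a >>= f).val = (f a).val := rfl

@[simp high] theorem steps_op_bind {α β : Type} (a : α) (f : α → Timed β) :
    (op a >>= f).steps = 1 + (f a).steps := rfl

/-- The membership proof passed to a loop body serves only termination; a body that ignores it gives
a plain left fold. -/
theorem val_forEach {α σ : Type} (l : List α) (s : σ) (f : α → σ → Timed σ) :
    (forEach l s fun a _ s => f a s).val = l.foldl (fun s a => (f a s).val) s := by
  induction l generalizing s with
  | nil => rfl
  | cons a l ih => simp only [forEach, val_bind, val_op, List.foldl_cons, ih]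

theorem steps_forEach_le {α σ : Type} (l : List α) (s : σ) (f : α → σ → Timed σ) (c : α → ℕ)
    (h : ∀ a ∈ l, ∀ s, (f a s).steps ≤ c a) :
    (forEach l s fun a _ s => f a s).steps ≤ 1 + (l.map fun a => 1 + c a).sum := by
  induction l generalizing s with
  | nil => simp [forEach]
  | cons a l ih =>
    simp only [forEach, steps_bind, steps_op, val_op, List.map_cons, List.sum_cons]
    have h1 := h a List.mem_cons_self s
    have h2 := ih (f a s).val fun b hb => h b (List.mem_cons_of_mem a hb)
    omega

end Timed

namespace WeightedTree

open Timed

variable {V : Type} (T : WeightedTree V) [Fintype V] [DecidableEq V]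

/-! ## The running time -/

theorem setDistances_eq (v : V) (D : V → ℝ) :
    T.setDistances v D = forEach (T.children v) D (fun u _ D => do
      let dv ← op (D v)
      let w ← op (T.weight s(v, u))
      let du ← op (dv + w)
      let D ← op (Function.update D u du)
      T.setDistances u D) := by
  rw [setDistances]

/-- The body of the loop of `setLabeling` that computes the label of `v`. -/
noncomputable def labelLoop (q : ℝ) (D : V → ℝ) (Λ : V → Label V) (v u : V)
    (s : ℕ × ℝ × Option V) : Timed (ℕ × ℝ × Option V) := do
  let lab ← op (Λ u)
  let k ← op (s.1 + lab.k)
  let dl ← op (D lab.ul)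
  let d ← op (dl - D v)
  let single ← op (decide (lab.k = 1))
  let near ← op (decide (d ≤ D v + q))
  let k ← op (if single && near then k - 1 else k)
  let farther ← op (decide (s.2.1 < d))
  if farther then op (k, d, some u) else op (k, s.2.1, s.2.2)

/-- The last lines of `setLabeling`, by which the label of `v` is stored. -/
noncomputable def storeLabel (Λ : V → Label V) (v : V) (s : ℕ × ℝ × Option V) :
    Timed (V → Label V) := do
  let k ← op (max 1 s.1)
  match s.2.2 with
  | none => pure Λ
  | some u => do
      let lab ← op (Λ u)
      op (Function.update Λ v ⟨k, lab.ul, some u⟩)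

/-- In this and the following unfoldings, `op ()` stands for an operation whose result has been
substituted in what follows, so that only its step remains. -/
theorem setLabeling_leaf (q : ℝ) (D : V → ℝ) {v : V} (Λ : V → Label V) (h : T.children v = []) :
    T.setLabeling q D v Λ = op () >>= fun _ => op (Function.update Λ v ⟨1, v, none⟩) := by
  rw [setLabeling, h]
  rfl

theorem setLabeling_node (q : ℝ) (D : V → ℝ) {v : V} (Λ : V → Label V) (h : T.children v ≠ []) :
    T.setLabeling q D v Λ = op () >>= fun _ =>
      (forEach (T.children v) Λ fun u _ Λ => T.setLabeling q D u Λ) >>= fun Λ =>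
      op () >>= fun _ => op () >>= fun _ =>
      (forEach (T.children v) (0, 0, none) fun u _ s => labelLoop q D Λ v u s) >>=
      storeLabel Λ v := by
  rw [setLabeling]
  have h' : (T.children v).isEmpty = false := by simpa using h
  rw [h']
  rfl

/-- The body of the loops of `setStrategy`. -/
noncomputable def strategyLoop (q : ℝ) (D : V → ℝ) (Λ : V → Label V) (v : V) (lastPass : Bool)
    (u : V) (S : List (Instr V)) : Timed (List (Instr V)) := do
  let isLast ← op (decide ((Λ v).uc = some u))
  if isLast = lastPass then
    let lab ← op (Λ u)
    let S ← op (S ++ [Instr.traverse v u lab.k])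
    let S ← T.setStrategy q D Λ u S
    let dl ← op (D lab.ul)
    let d ← op (dl - D v)
    let near ← op (decide (d ≤ D v + q))
    if near && !isLast then op (S ++ [Instr.sendBack lab.ul v]) else pure S
  else
    pure S

theorem setStrategy_leaf (q : ℝ) (D : V → ℝ) (Λ : V → Label V) {v : V} (S : List (Instr V))
    (h : T.children v = []) : T.setStrategy q D Λ v S = op () >>= fun _ => pure S := by
  rw [setStrategy, h]
  rfl

theorem setStrategy_node (q : ℝ) (D : V → ℝ) (Λ : V → Label V) {v : V} (S : List (Instr V))
    (h : T.children v ≠ []) : T.setStrategy q D Λ v S = op () >>= fun _ => op () >>= fun _ =>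
      op () >>= fun _ =>
      (if v = T.root then op (S ++ [Instr.invoke (Λ v).k]) else pure S) >>= fun S =>
      op () >>= fun _ => op () >>= fun _ =>
      (forEach [false, true] S fun b _ S =>
        forEach (T.children v) S fun u _ S => T.strategyLoop q D Λ v b u S) := by
  rw [setStrategy]
  have h' : (T.children v).isEmpty = false := by simpa using h
  rw [h']
  by_cases hv : v = T.root
  · simp only [hv, decide_true, if_true]
    rfl
  · simp only [hv, decide_false, if_false]
    rfl

theorem steps_labelLoop (q : ℝ) (D : V → ℝ) (Λ : V → Label V) (v u : V)
    (s : ℕ × ℝ × Option V) : (labelLoop q D Λ v u s).steps = 9 := by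
  simp only [labelLoop, steps_op_bind]
  split <;> rfl

theorem steps_storeLabel_le (Λ : V → Label V) (v : V) (s : ℕ × ℝ × Option V) :
    (storeLabel Λ v s).steps ≤ 3 := by
  obtain ⟨k, dmax, _ | u⟩ := s <;> simp [storeLabel]

theorem steps_strategyLoop_le (q : ℝ) (D : V → ℝ) (Λ : V → Label V) (v : V) (b : Bool)
    (u : V) (S : List (Instr V)) (c : ℕ) (hc : ∀ S, (T.setStrategy q D Λ u S).steps ≤ c) :
    (T.strategyLoop q D Λ v b u S).steps ≤
      1 + if decide ((Λ v).uc = some u) = b then 7 + c else 0 := by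
  simp only [strategyLoop, steps_op_bind]
  split
  · have := hc (S ++ [Instr.traverse v u (Λ u).k])
    simp only [steps_op_bind, steps_bind (T.setStrategy _ _ _ _ _)]
    split <;> simp only [steps_op, steps_pure] <;> omega
  · simp

/-- A recursion over the tree with `a` steps at every vertex and `b` steps for every child takes
at most `a + b` steps for every vertex, apart from the `b` steps for the vertex itself. -/
theorem add_sum_map_children_le (v : V) (a b : ℕ) :
    a + ((T.children v).map fun u => b + ((a + b) * (T.descendants u).length - b)).sum ≤
      (a + b) * (T.descendants v).length - b := by
  have h : (T.children v).map (fun u => b + ((a + b) * (T.descendants u).length - b)) =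
      (T.children v).map fun u => (a + b) * (T.descendants u).length := by
    refine List.map_congr_left fun u _ => ?_
    have h1 : 1 ≤ (T.descendants u).length := by rw [length_descendants]; omega
    have h2 : (a + b) * 1 ≤ (a + b) * (T.descendants u).length := Nat.mul_le_mul_left _ h1
    omega
  rw [h, List.sum_map_mul_left, T.length_descendants v, mul_add]
  omega

/-- Per vertex, one final loop test; per child, one loop test and four operations. -/
theorem steps_setDistances_le (v : V) (D : V → ℝ) :
    (T.setDistances v D).steps ≤ (1 + 5) * (T.descendants v).length - 5 := by
  induction v using T.child_induction generalizing D with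
  | _ v ih =>
    rw [setDistances_eq]
    refine (steps_forEach_le _ _ _
      (fun u => 4 + ((1 + 5) * (T.descendants u).length - 5)) fun u hu D => ?_).trans ?_
    · simp only [steps_bind, steps_op, val_op]
      have := ih u hu
      grind
    · refine le_trans (le_of_eq ?_) (T.add_sum_map_children_le v 1 5)
      congr 2
      refine List.map_congr_left fun u _ => ?_
      omega

/-- Per vertex, 8 steps: the leaf test, two final loop tests, two operations for `D v + q`, and at
most three to store the label. Per child, 11 steps: two loop tests and the nine steps of
`labelLoop`. -/
theorem steps_setLabeling_le (q : ℝ) (D : V → ℝ) (v : V) (Λ : V → Label V) :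
    (T.setLabeling q D v Λ).steps ≤ (8 + 11) * (T.descendants v).length - 11 := by
  induction v using T.child_induction generalizing Λ with
  | _ v ih =>
    refine le_trans ?_ (T.add_sum_map_children_le v 8 11)
    by_cases h : T.children v = []
    · rw [T.setLabeling_leaf q D Λ h]
      simp [h]
    · rw [T.setLabeling_node q D Λ h]
      simp only [steps_bind, steps_op]
      have h1 := steps_forEach_le (T.children v) Λ (fun u Λ => T.setLabeling q D u Λ)
        (fun u => (8 + 11) * (T.descendants u).length - 11) fun u hu Λ => ih u hu Λ
      generalize forEach (T.children v) Λ (fun u _ Λ => T.setLabeling q D u Λ) = x at h1 ⊢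
      have h2 := steps_forEach_le (T.children v) (0, 0, none)
        (fun u s => labelLoop q D x.val v u s) (fun _ => 9) fun u _ s =>
          (steps_labelLoop q D x.val v u s).le
      generalize forEach (T.children v) (0, 0, none) (fun u _ s => labelLoop q D x.val v u s) = y
        at h2 ⊢
      have h3 := steps_storeLabel_le x.val v y.val
      simp only [List.sum_map_add, List.map_const', List.sum_replicate, smul_eq_mul] at h1 h2 ⊢
      omega

/-- Per vertex, 11 steps: at most six before the loops, three tests of the outer loop and one final
test of each inner loop. -/
theorem steps_setStrategy_le (q : ℝ) (D : V → ℝ) (Λ : V → Label V) (v : V)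
    (S : List (Instr V)) :
    (T.setStrategy q D Λ v S).steps ≤ (11 + 11) * (T.descendants v).length - 11 := by
  induction v using T.child_induction generalizing S with
  | _ v ih =>
    refine le_trans ?_ (T.add_sum_map_children_le v 11 11)
    by_cases h : T.children v = []
    · rw [T.setStrategy_leaf q D Λ S h]
      simp [h]
    · rw [T.setStrategy_node q D Λ S h]
      simp only [forEach, steps_bind, steps_op, val_op]
      have h0 : (if v = T.root then op (S ++ [Instr.invoke (Λ v).k])
        else pure S : Timed _).steps ≤ 1 := by split <;> simp
      generalize (if v = T.root then op (S ++ [Instr.invoke (Λ v).k])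
        else pure S : Timed _) = y at h0 ⊢
      have hb (b : Bool) (S : List (Instr V)) := steps_forEach_le (T.children v) S
        (fun u S => T.strategyLoop q D Λ v b u S) _ fun u hu S =>
          T.steps_strategyLoop_le q D Λ v b u S _ (ih u hu)
      have h1 := hb false y.val
      generalize forEach (T.children v) y.val
        (fun u _ S => T.strategyLoop q D Λ v false u S) = z at h1 ⊢
      have h2 := hb true z.val
      -- Each child is processed in exactly one of the two passes, so its recursive call is counted
      -- once; its 11 steps are two loop tests, two comparisons with `uc` and at most 7 for the
      -- processing.
      have h3 : ((T.children v).map fun u => 1 + (1 + if decide ((Λ v).uc = some u) = false then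
          7 + ((11 + 11) * (T.descendants u).length - 11) else 0)).sum +
          ((T.children v).map fun u => 1 + (1 + if decide ((Λ v).uc = some u) = true then
          7 + ((11 + 11) * (T.descendants u).length - 11) else 0)).sum =
          ((T.children v).map fun u => 11 + ((11 + 11) * (T.descendants u).length - 11)).sum := by
        rw [← List.sum_map_add]
        congr 1
        refine List.map_congr_left fun u _ => ?_
        by_cases hu : (Λ v).uc = some u <;> simp [hu] <;> omega
      omega

/-- The constant is 2 for the two allocations, plus 6, 19 and 22 from the three recursions. -/
theorem steps_costExpl_le (q : ℝ) : (T.costExpl q).steps ≤ 49 * Fintype.card V := by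
  have h1 := T.steps_setDistances_le T.root
  have h2 := T.steps_setLabeling_le q
  have h3 := T.steps_setStrategy_le q
  have h4 := T.length_descendants_root_le
  simp only [costExpl, steps_bind]
  grind [alloc]

end WeightedTree

namespace WeightedTree

open Timed

variable {V : Type} (T : WeightedTree V) [Fintype V] [DecidableEq V]

/-! ## The computed values -/

theorem val_setDistances (v : V) (D : V → ℝ) (hD : D v = T.depth v) :
    (T.setDistances v D).val = fun x => if x ∈ T.descendants v then T.depth x else D x := by
  induction v using T.child_induction generalizing D with
  | _ v ih =>
    have key : ∀ l : List V, l ⊆ T.children v → ∀ D : V → ℝ, D v = T.depth v →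
        l.foldl (fun s u => (T.setDistances u
          (Function.update s u (s v + T.weight s(v, u)))).val) D =
          fun x => if ∃ u ∈ l, x ∈ T.descendants u then T.depth x else D x := by
      intro l
      induction l with
      | nil => intro _ D _; simp
      | cons u l ihl =>
        intro hl D hD
        have hu : u ∈ T.children v := hl List.mem_cons_self
        have hdu : D v + T.weight s(v, u) = T.depth u := by
          rw [hD, T.depth_child hu, T.parentWeight_child hu]
        rw [List.foldl_cons, hdu, ih u hu _ (by simp), ihl (fun x hx => hl (List.mem_cons_of_mem _ hx))]
        · funext x
          by_cases h1 : ∃ u ∈ l, x ∈ T.descendants u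
          · simp [h1]
          · by_cases h2 : x ∈ T.descendants u
            · simp [h2]
            · have : x ≠ u := by rintro rfl; exact h2 (T.mem_descendants_self x)
              simp [h2, this]
        · simp [T.not_mem_descendants_child hu, hD, (T.child_ne hu).symm]
    rw [setDistances_eq, val_forEach]
    refine (key _ (List.Subset.refl _) D hD).trans ?_
    funext x
    simp only [T.mem_descendants (v := v)]
    by_cases hx : x = v
    · subst hx; simp [hD]
    · simp [hx]

theorem val_setDistances_root : (T.setDistances T.root fun _ => 0).val = T.depth := by
  rw [T.val_setDistances _ _ T.depth_root.symm]
  simp [T.mem_descendants_root]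

/-- One step in the computation of a label. -/
noncomputable def labelStep (q : ℝ) (Λ : V → Label V) (v : V) (s : ℕ × ℝ × Option V) (u : V) :
    ℕ × ℝ × Option V :=
  (labelLoop q T.depth Λ v u s).val

/-- The triple that `setLabeling` computes at `v` from the labels of the children. -/
noncomputable def labelFold (q : ℝ) (Λ : V → Label V) (v : V) : ℕ × ℝ × Option V :=
  (T.children v).foldl (T.labelStep q Λ v) (0, 0, none)

theorem labelFold_congr (q : ℝ) (Λ Λ' : V → Label V) (v : V)
    (h : ∀ u ∈ T.children v, Λ u = Λ' u) : T.labelFold q Λ v = T.labelFold q Λ' v := by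
  refine List.foldl_ext _ _ _ fun s u hu => ?_
  simp only [labelStep, labelLoop, h u hu]

/-- The label that `setLabeling` computes for a vertex. -/
noncomputable def label (q : ℝ) (v : V) : Label V :=
  (T.setLabeling q T.depth v fun _ => ⟨0, T.root, none⟩).val v

theorem label_leaf (q : ℝ) {v : V} (h : T.children v = []) : T.label q v = ⟨1, v, none⟩ := by
  rw [label, T.setLabeling_leaf _ _ _ h]
  simp

/-- The height of the subtree at `v`, as measured by the label of `v`. -/
noncomputable def height (q : ℝ) (v : V) : ℝ := T.depth (T.label q v).ul - T.depth v

/-- Whether an agent at the deepest vertex below `u` returns to the parent of `u`, unless `u` is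
handled last. -/
def Near (q : ℝ) (u : V) : Prop :=
  T.parentWeight u + T.height q u ≤ T.depth u - T.parentWeight u + q

open Classical in
/-- The number of agents that stay below `u` if `u` is not handled last. -/
noncomputable def staying (q : ℝ) (u : V) : ℕ := if T.Near q u then 0 else (T.label q u).k

theorem labelLoop_near_iff (q : ℝ) {v u : V} (hu : u ∈ T.children v) :
    T.depth (T.label q u).ul - T.depth v ≤ T.depth v + q ↔ T.Near q u := by
  rw [Near, height, T.depth_child hu]
  constructor <;> intro <;> linarith


/-- Under `hk` the test for a single agent is implied by nearness, and the natural subtraction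
removes precisely the one agent just added. -/
theorem labelStep_eq (q : ℝ) {v u : V} (hu : u ∈ T.children v)
    (hk : T.Near q u → (T.label q u).k = 1) (s : ℕ × ℝ × Option V) :
    T.labelStep q (T.label q) v s u = (s.1 + T.staying q u,
      if s.2.1 < T.depth (T.label q u).ul - T.depth v then
        (T.depth (T.label q u).ul - T.depth v, some u) else s.2) := by
  have h1 : (if (decide ((T.label q u).k = 1) &&
      decide (T.depth (T.label q u).ul - T.depth v ≤ T.depth v + q)) = true then
      s.1 + (T.label q u).k - 1 else s.1 + (T.label q u).k) = s.1 + T.staying q u := by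
    simp only [staying, Bool.and_eq_true, decide_eq_true_eq, T.labelLoop_near_iff q hu]
    by_cases h : T.Near q u
    · have h2 := (T.labelLoop_near_iff q hu).2 h
      simp [h, hk h]
      linarith
    · have h2 := mt (T.labelLoop_near_iff q hu).1 h
      simp [h]
      intro _ h3
      exact absurd (by linarith) h2
  simp only [labelStep, labelLoop, val_op_bind, h1]
  by_cases h2 : s.2.1 < T.depth (T.label q u).ul - T.depth v <;> simp [h2]

theorem labelFold_spec (q : ℝ) {v : V} (hne : T.children v ≠ [])
    (hk : ∀ u ∈ T.children v, T.Near q u → (T.label q u).k = 1)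
    (hul : ∀ u ∈ T.children v, (T.label q u).ul ∈ T.descendants u) :
    (T.labelFold q (T.label q) v).1 = ((T.children v).map (T.staying q)).sum ∧
    ∃ u ∈ T.children v, (T.labelFold q (T.label q) v).2.2 = some u ∧
      ∀ u' ∈ T.children v, T.depth (T.label q u').ul ≤ T.depth (T.label q u).ul := by
  have key : ∀ l : List V, l ⊆ T.children v → ∀ s : ℕ × ℝ × Option V,
      (l.foldl (T.labelStep q (T.label q) v) s).1 = s.1 + (l.map (T.staying q)).sum ∧
      (((l.foldl (T.labelStep q (T.label q) v) s).2 = s.2 ∧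
        ∀ u ∈ l, T.depth (T.label q u).ul - T.depth v ≤ s.2.1) ∨
      ∃ u ∈ l, (l.foldl (T.labelStep q (T.label q) v) s).2.2 = some u ∧
        s.2.1 ≤ T.depth (T.label q u).ul - T.depth v ∧
        ∀ u' ∈ l, T.depth (T.label q u').ul ≤ T.depth (T.label q u).ul) := by
    intro l
    induction l with
    | nil => intro _ s; simp
    | cons a l ih =>
      intro hl s
      have ha : a ∈ T.children v := hl List.mem_cons_self
      obtain ⟨h1, h2⟩ := ih (fun x hx => hl (List.mem_cons_of_mem _ hx))
        (T.labelStep q (T.label q) v s a)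
      rw [List.foldl_cons]
      refine ⟨?_, ?_⟩
      · rw [h1, T.labelStep_eq q ha (hk a ha)]
        simp [add_assoc]
      · rw [T.labelStep_eq q ha (hk a ha)] at h2 ⊢
        by_cases hlt : s.2.1 < T.depth (T.label q a).ul - T.depth v
        · simp only [hlt, if_true] at h2 ⊢
          right
          rcases h2 with ⟨h2, h3⟩ | ⟨u, hu, h2, h3, h4⟩
          · refine ⟨a, List.mem_cons_self, by rw [h2], hlt.le, ?_⟩
            simp only [List.mem_cons, forall_eq_or_imp, le_refl, true_and]
            intro u hu
            linarith [h3 u hu]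
          · refine ⟨u, List.mem_cons_of_mem _ hu, h2, hlt.le.trans h3, ?_⟩
            simp only [List.mem_cons, forall_eq_or_imp]
            exact ⟨by linarith, h4⟩
        · simp only [hlt, if_false] at h2 ⊢
          rcases h2 with ⟨h2, h3⟩ | ⟨u, hu, h2, h3, h4⟩
          · left
            refine ⟨h2, ?_⟩
            simp only [List.mem_cons, forall_eq_or_imp]
            exact ⟨not_lt.1 hlt, h3⟩
          · right
            refine ⟨u, List.mem_cons_of_mem _ hu, h2, h3, ?_⟩
            simp only [List.mem_cons, forall_eq_or_imp]
            exact ⟨by linarith, h4⟩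
  obtain ⟨h1, h2⟩ := key _ (List.Subset.refl _) (0, 0, none)
  refine ⟨h1.trans (zero_add _), ?_⟩
  -- The first case, where the maximum keeps its initial value 0, is impossible: edge weights are
  -- positive, so any child already beats 0. Hence `uc` is never `none` at a vertex with children.
  rcases h2 with ⟨-, h3⟩ | ⟨u, hu, h2, -, h4⟩
  · obtain ⟨u, hu⟩ := List.exists_mem_of_ne_nil _ hne
    have h5 := h3 u hu
    have h6 := T.depth_le_of_mem_descendants (hul u hu)
    have h7 := T.depth_child hu
    have h8 := T.parentWeight_pos hu
    simp only at h5
    linarith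
  · exact ⟨u, hu, h2, h4⟩

/-- The clauses are proved in one induction because the label of `v` is computed from labels of the
children whose shape must already be known. The first clause also shows that the stored labels do
not depend on the initial array. -/
theorem val_setLabeling_and_label (q : ℝ) (v : V) :
    (∀ Λ, (T.setLabeling q T.depth v Λ).val =
      fun x => if x ∈ T.descendants v then T.label q x else Λ x) ∧
    (T.label q v).ul ∈ T.descendants v ∧
    (T.height q v ≤ T.depth v + q → (T.label q v).k = 1) ∧
    (T.children v ≠ [] → (T.label q v).k = max 1 ((T.children v).map (T.staying q)).sum ∧
      ∃ u ∈ T.children v, (T.label q v).uc = some u ∧ (T.label q v).ul = (T.label q u).ul ∧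
        ∀ u' ∈ T.children v, T.depth (T.label q u').ul ≤ T.depth (T.label q u).ul) := by
  induction v using T.child_induction with
  | _ v ih =>
    by_cases h : T.children v = []
    · rw [T.label_leaf q h]
      refine ⟨fun Λ => ?_, T.mem_descendants_self v, fun _ => rfl, fun h' => absurd h h'⟩
      rw [T.setLabeling_leaf q T.depth Λ h]
      funext x
      by_cases hx : x = v
      · subst hx
        simp [T.mem_descendants_self, T.label_leaf q h]
      · have : x ∉ T.descendants v := by simp [T.descendants_leaf h, hx]
        simp [this, hx]
    · have hk : ∀ u ∈ T.children v, T.Near q u → (T.label q u).k = 1 := fun u hu hn =>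
        (ih u hu).2.2.1 (by
          have := T.parentWeight_nonneg u
          rw [Near] at hn
          linarith)
      obtain ⟨hs, u, hu, huc, hmax⟩ := T.labelFold_spec q h hk fun u hu => (ih u hu).2.1
      have hfold : ∀ l : List V, l ⊆ T.children v → ∀ Λ : V → Label V,
          l.foldl (fun Λ u => (T.setLabeling q T.depth u Λ).val) Λ =
            fun x => if ∃ u ∈ l, x ∈ T.descendants u then T.label q x else Λ x := by
        intro l
        induction l with
        | nil => intro _ Λ; simp
        | cons a l ihl =>
          intro hl Λ
          rw [List.foldl_cons, (ih a (hl List.mem_cons_self)).1,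
            ihl (fun x hx => hl (List.mem_cons_of_mem _ hx))]
          funext x
          by_cases h1 : ∃ u ∈ l, x ∈ T.descendants u
          · simp [h1]
          · by_cases h2 : x ∈ T.descendants a <;> simp [h1, h2]
      have hval : ∀ Λ, (T.setLabeling q T.depth v Λ).val = Function.update
          (fun x => if ∃ u ∈ T.children v, x ∈ T.descendants u then T.label q x else Λ x) v
          ⟨max 1 (T.labelFold q (T.label q) v).1, (T.label q u).ul, some u⟩ := by
        intro Λ
        rw [T.setLabeling_node q T.depth Λ h]
        simp only [val_bind, val_forEach]
        rw [hfold _ (List.Subset.refl _) Λ]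
        set Λ' : V → Label V :=
          fun x => if ∃ u ∈ T.children v, x ∈ T.descendants u then T.label q x else Λ x with hΛ'
        have hc : ∀ u ∈ T.children v, Λ' u = T.label q u := fun u hu => by
          rw [hΛ']
          exact if_pos ⟨u, hu, T.mem_descendants_self u⟩
        have hf : (T.children v).foldl (fun s u => (labelLoop q T.depth Λ' v u s).val)
            (0, 0, none) = T.labelFold q (T.label q) v := T.labelFold_congr q _ _ v hc
        rw [hf]
        simp only [storeLabel, huc, val_op_bind, val_op, hc u hu]
      have hlab : T.label q v =
          ⟨max 1 (T.labelFold q (T.label q) v).1, (T.label q u).ul, some u⟩ := by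
        rw [label, hval]
        simp
      refine ⟨fun Λ => ?_, ?_, ?_, ?_⟩
      · rw [hval, ← hlab]
        funext x
        by_cases hx : x = v
        · subst hx
          simp [T.mem_descendants_self]
        · simp [T.mem_descendants (v := v), hx]
      · rw [hlab]
        exact T.mem_descendants_of_child hu (ih u hu).2.1
      · intro hh
        rw [hlab, hs]
        rw [height, hlab] at hh
        -- If even the deepest vertex below `v` lies within `depth v + q` of `v`, every child is
        -- near and contributes no staying agent; the label is then the 1 in `max 1 k`.
        have h0 : ((T.children v).map (T.staying q)).sum = 0 := by
          refine List.sum_eq_zero fun n hn => ?_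
          obtain ⟨u', hu', rfl⟩ := List.mem_map.1 hn
          refine if_pos ((T.labelLoop_near_iff q hu').1 ?_)
          have := hmax u' hu'
          simp only at hh
          linarith
        simp [h0]
      · intro _
        rw [hlab]
        exact ⟨by rw [hs], u, hu, rfl, rfl, hmax⟩

theorem val_setLabeling_root (q : ℝ) (Λ : V → Label V) :
    (T.setLabeling q T.depth T.root Λ).val = T.label q := by
  rw [(T.val_setLabeling_and_label q _).1]
  simp [T.mem_descendants_root]

section Label

variable (q : ℝ)

theorem label_ul_mem (v : V) : (T.label q v).ul ∈ T.descendants v :=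
  (T.val_setLabeling_and_label q v).2.1

theorem label_k_eq_one {v : V} (h : T.height q v ≤ T.depth v + q) : (T.label q v).k = 1 :=
  (T.val_setLabeling_and_label q v).2.2.1 h

theorem label_k_node {v : V} (h : T.children v ≠ []) :
    (T.label q v).k = max 1 ((T.children v).map (T.staying q)).sum :=
  ((T.val_setLabeling_and_label q v).2.2.2 h).1

theorem label_k_pos (v : V) : 1 ≤ (T.label q v).k := by
  by_cases h : T.children v = []
  · rw [T.label_leaf q h]
  · rw [T.label_k_node q h]
    exact le_max_left _ _

theorem height_nonneg (v : V) : 0 ≤ T.height q v :=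
  sub_nonneg.2 (T.depth_le_of_mem_descendants (T.label_ul_mem q v))

theorem label_uc {v : V} (h : T.children v ≠ []) :
    ∃ u ∈ T.children v, (T.label q v).uc = some u ∧ (T.label q v).ul = (T.label q u).ul ∧
      T.height q v = T.parentWeight u + T.height q u ∧
      ∀ u' ∈ T.children v, T.parentWeight u' + T.height q u' ≤ T.height q v := by
  obtain ⟨-, u, hu, h1, h2, h3⟩ := (T.val_setLabeling_and_label q v).2.2.2 h
  refine ⟨u, hu, h1, h2, ?_, fun u' hu' => ?_⟩
  · rw [height, height, h2, T.depth_child hu]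
    ring
  · rw [height, height, h2]
    have := h3 u' hu'
    have := T.depth_child hu'
    linarith

theorem near_label_k {u : V} (h : T.Near q u) : (T.label q u).k = 1 :=
  T.label_k_eq_one q (by
    have := T.parentWeight_nonneg u
    rw [Near] at h
    linarith)

end Label

end WeightedTree

namespace WeightedTree

open Timed

variable {V : Type} (T : WeightedTree V) [Fintype V] [DecidableEq V]

/-! ## The computed list of instructions -/

/-- The instructions added by `setStrategy` at `v`. -/
noncomputable def program (q : ℝ) (v : V) : List (Instr V) :=
  (T.setStrategy q T.depth (T.label q) v []).val

/-- The instructions for the exploration below a child `u` of `v`, without a way back. -/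
noncomputable def enter (q : ℝ) (v u : V) : List (Instr V) :=
  Instr.traverse v u (T.label q u).k :: T.program q u

open Classical in
/-- The instructions for the exploration below a child `u` of `v` that is not handled last. -/
noncomputable def visit (q : ℝ) (v u : V) : List (Instr V) :=
  T.enter q v u ++ if T.Near q u then [Instr.sendBack (T.label q u).ul v] else []

theorem val_setStrategy (q : ℝ) (v : V) (S : List (Instr V)) :
    (T.setStrategy q T.depth (T.label q) v S).val = S ++ T.program q v ∧
    (T.children v = [] → T.program q v = []) ∧
    (T.children v ≠ [] → T.program q v =
      (if v = T.root then [Instr.invoke (T.label q v).k] else []) ++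
      ((T.children v).flatMap fun u => if (T.label q v).uc = some u then [] else T.visit q v u) ++
      ((T.children v).flatMap fun u => if (T.label q v).uc = some u then T.enter q v u else [])) := by
  induction v using T.child_induction generalizing S with
  | _ v ih =>
    by_cases h : T.children v = []
    · simp [program, T.setStrategy_leaf _ _ _ _ h, h]
    · have hloop : ∀ b : Bool, ∀ u ∈ T.children v, ∀ S : List (Instr V),
          (T.strategyLoop q T.depth (T.label q) v b u S).val = S ++
            if (T.label q v).uc = some u then (if b then T.enter q v u else [])
            else (if b then [] else T.visit q v u) := by
        intro b u hu S
        simp only [strategyLoop, val_op_bind]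
        by_cases hl : (T.label q v).uc = some u <;> cases b
        · simp [hl]
        · simp [hl, (ih u hu _).1, enter]
        · by_cases hn : T.Near q u
          · have h2 := (T.labelLoop_near_iff q hu).2 hn
            simp only [hl, decide_false, if_true, val_op_bind, val_bind (T.setStrategy _ _ _ _ _),
              (ih u hu _).1, h2, decide_true, Bool.not_false, Bool.and_true, val_op]
            simp [visit, enter, hn]
          · have h2 := mt (T.labelLoop_near_iff q hu).1 hn
            simp only [hl, decide_false, if_true, val_op_bind, val_bind (T.setStrategy _ _ _ _ _),
              (ih u hu _).1, h2, Bool.not_false, Bool.and_true]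
            simp [visit, enter, hn]
        · simp [hl]
      have hfold : ∀ b : Bool, ∀ l : List V, l ⊆ T.children v → ∀ S : List (Instr V),
          l.foldl (fun S u => (T.strategyLoop q T.depth (T.label q) v b u S).val) S = S ++
            l.flatMap fun u => if (T.label q v).uc = some u then (if b then T.enter q v u else [])
              else (if b then [] else T.visit q v u) := by
        intro b l
        induction l with
        | nil => simp
        | cons a l ihl =>
          intro hl S
          rw [List.foldl_cons, hloop b a (hl List.mem_cons_self),
            ihl fun x hx => hl (List.mem_cons_of_mem _ hx), List.flatMap_cons, List.append_assoc]
      have hval : ∀ S, (T.setStrategy q T.depth (T.label q) v S).val = S ++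
          ((if v = T.root then [Instr.invoke (T.label q v).k] else []) ++
          ((T.children v).flatMap fun u => if (T.label q v).uc = some u then []
            else T.visit q v u) ++
          ((T.children v).flatMap fun u => if (T.label q v).uc = some u then T.enter q v u
            else [])) := by
        intro S
        rw [T.setStrategy_node q _ _ _ h]
        simp only [val_bind, val_forEach, List.foldl_cons, List.foldl_nil,
          hfold _ _ (List.Subset.refl _)]
        by_cases hr : v = T.root <;> simp [hr]
      refine ⟨?_, fun h' => absurd h' h, fun _ => ?_⟩
      · rw [hval, program, hval, List.nil_append]
      · rw [program, hval, List.nil_append]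

theorem program_leaf (q : ℝ) {v : V} (h : T.children v = []) : T.program q v = [] :=
  (T.val_setStrategy q v []).2.1 h

/-- As the list of children has no duplicates, the first pass visits all of them except `w`, and the
second pass only enters `w`. -/
theorem program_node (q : ℝ) {v w : V} (hw : w ∈ T.children v) (huc : (T.label q v).uc = some w) :
    T.program q v = (if v = T.root then [Instr.invoke (T.label q v).k] else []) ++
      (((T.children v).erase w).flatMap (T.visit q v) ++ T.enter q v w) := by
  have h1 := (T.val_setStrategy q v []).2.2 (List.ne_nil_of_mem hw)
  rw [h1, List.append_assoc, huc]
  congr 1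
  have hnd := T.children_nodup v
  obtain ⟨l₁, l₂, h⟩ := List.append_of_mem hw
  rw [h] at hnd ⊢
  rw [List.nodup_middle, List.nodup_cons, List.mem_append, not_or] at hnd
  rw [List.erase_append_right _ hnd.1.1, List.erase_cons_head]
  have e1 : ∀ l : List V, w ∉ l → (l.flatMap fun u => if some w = some u then [] else
      T.visit q v u) = l.flatMap (T.visit q v) := fun l hl => by
    refine List.flatMap_congr fun u hu => if_neg ?_
    rintro ⟨⟩
    exact hl hu
  have e2 : ∀ l : List V, w ∉ l → (l.flatMap fun u => if some w = some u then T.enter q v u else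
      []) = [] := fun l hl => by
    rw [List.flatMap_eq_nil_iff]
    intro u hu
    refine if_neg ?_
    rintro ⟨⟩
    exact hl hu
  simp only [List.flatMap_append, List.flatMap_cons, e1 _ hnd.1.1, e1 _ hnd.1.2, e2 _ hnd.1.1,
    e2 _ hnd.1.2]
  simp

theorem val_costExpl (q : ℝ) : (T.costExpl q).val = T.program q T.root := by
  simp only [costExpl, val_bind, alloc]
  rw [val_setDistances_root, val_setLabeling_root]
  rfl

/-! ## The costs of the computed strategy -/

open Classical in
/-- The cost of the exploration of the subtree at `v` from its parent, where agents that return are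
not charged for the way to the parent. -/
noncomputable def detour (q : ℝ) (v : V) : ℝ :=
  if T.Near q v then 2 * T.subtreeSum T.parentWeight v else
    ((T.children v).attach.map fun u => detour q u.1).sum + max 0 (T.depth v + q - T.height q v)
termination_by Fintype.card V - T.graph.dist T.root v
decreasing_by exact T.measure_lt u.2

/-- The cost of the exploration of the subtree at `v` by agents that stay there, including their
invocation and the way to `v`. -/
noncomputable def serve (q : ℝ) (v : V) : ℝ :=
  ((T.children v).map (T.detour q)).sum + max 0 (T.depth v + q - T.height q v)

theorem detour_near {q : ℝ} {v : V} (h : T.Near q v) :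
    T.detour q v = 2 * T.subtreeSum T.parentWeight v := by
  rw [detour, if_pos h]

theorem detour_not_near {q : ℝ} {v : V} (h : ¬ T.Near q v) : T.detour q v = T.serve q v := by
  rw [detour, if_neg h, serve, List.attach_map_val (f := T.detour q)]

theorem staying_near {q : ℝ} {v : V} (h : T.Near q v) : T.staying q v = 0 := if_pos h

theorem staying_not_near {q : ℝ} {v : V} (h : ¬ T.Near q v) :
    T.staying q v = (T.label q v).k := if_neg h

theorem near_iff {q : ℝ} {v u : V} (hu : u ∈ T.children v) :
    T.Near q u ↔ T.parentWeight u + T.height q u ≤ T.depth v + q := by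
  rw [Near, T.depth_child hu, add_sub_cancel_right]

theorem height_le_of_near {q : ℝ} {v : V} (h : T.Near q v) : T.height q v ≤ T.depth v + q := by
  have := T.parentWeight_nonneg v
  rw [Near] at h
  linarith

theorem near_child {q : ℝ} {v u : V} (h : T.height q v ≤ T.depth v + q)
    (hu : u ∈ T.children v) : T.Near q u := by
  obtain ⟨w, -, -, -, -, hmax⟩ := T.label_uc q (List.ne_nil_of_mem hu)
  exact (T.near_iff hu).2 ((hmax u hu).trans h)

theorem serve_of_height_le {q : ℝ} {v : V} (h : T.height q v ≤ T.depth v + q) :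
    T.serve q v = 2 * T.subtreeSum T.parentWeight v - 2 * T.parentWeight v +
      (T.depth v + q - T.height q v) := by
  rw [serve, max_eq_right (by linarith), T.subtreeSum_eq,
    List.map_congr_left fun u hu => T.detour_near (T.near_child h hu), List.sum_map_mul_left]
  ring

/-- Not returning from the child handled last accounts for the `max` term in `serve q v`: it is what
`serve q w` exceeds `detour q w` by. -/
theorem serve_last {q : ℝ} {v w : V} (hw : w ∈ T.children v)
    (hh : T.height q v = T.parentWeight w + T.height q w) :
    T.serve q w = T.detour q w + max 0 (T.depth v + q - T.height q v) := by
  by_cases h : T.Near q w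
  · have h1 := (T.near_iff hw).1 h
    rw [T.detour_near h, T.serve_of_height_le (T.height_le_of_near h), T.depth_child hw,
      max_eq_right (by linarith), hh]
    ring
  · rw [T.detour_not_near h, max_eq_left, add_zero]
    rw [T.near_iff hw] at h
    linarith

/-- Agents are balanced at `v`: those present are the ones that stay below the other children and
the ones sent to `w`. If `w` is near, so are all children, and the single agent visits them all
before it enters `w`. -/
theorem label_k_last {q : ℝ} {v w : V} (hw : w ∈ T.children v)
    (hh : T.height q v = T.parentWeight w + T.height q w) :
    (T.label q v).k = (((T.children v).erase w).map (T.staying q)).sum + (T.label q w).k := by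
  by_cases h : T.Near q w
  · have h1 : T.height q v ≤ T.depth v + q := hh ▸ (T.near_iff hw).1 h
    rw [T.label_k_eq_one q h1, T.near_label_k q h, List.map_congr_left fun u hu =>
      T.staying_near (T.near_child h1 (List.mem_of_mem_erase hu))]
    simp
  · rw [T.label_k_node q (List.ne_nil_of_mem hw), ← T.staying_not_near h, add_comm,
      ← List.sum_cons, ← List.map_cons, ((List.perm_cons_erase hw).map _).sum_eq]
    refine max_eq_right ?_
    have := T.label_k_pos q w
    simp only [List.map_cons, List.sum_cons, T.staying_not_near h]
    omega

end WeightedTree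

namespace WeightedTree

variable {V : Type} (T : WeightedTree V)

/-! ## Moves described by instructions -/

/-- The total distance traversed in a sequence of moves. -/
def travel (S : List (Move V)) : ℝ :=
  (S.map fun m => match m with
    | .invoke => 0
    | .traverse _ u v => T.weight s(u, v)).sum

@[simp] theorem travel_nil : T.travel [] = 0 := rfl

@[simp] theorem travel_append (S S' : List (Move V)) :
    T.travel (S ++ S') = T.travel S + T.travel S' := by simp [travel]

@[simp] theorem _root_.numAgents_nil : numAgents ([] : List (Move V)) = 0 := rfl

@[simp] theorem _root_.numAgents_append (S S' : List (Move V)) :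
    numAgents (S ++ S') = numAgents S + numAgents S' := by simp [numAgents]

theorem legalFrom_append (pos : List V) (S S' : List (Move V)) :
    T.LegalFrom pos (S ++ S') ↔ T.LegalFrom pos S ∧ T.LegalFrom (S.foldl T.after pos) S' := by
  induction S generalizing pos with
  | nil => simp [LegalFrom]
  | cons m S ih => simp [LegalFrom, ih, and_assoc]

theorem expands_append (pos : List V) (L L' : List (Instr V)) (S : List (Move V)) :
    T.Expands pos (L ++ L') S ↔ ∃ S₁ S₂, S = S₁ ++ S₂ ∧ T.Expands pos L S₁ ∧
      T.Expands (S₁.foldl T.after pos) L' S₂ := by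
  induction L generalizing pos S with
  | nil => simp [Expands]
  | cons I L ih =>
    simp only [List.cons_append, Expands, ih]
    constructor
    · rintro ⟨S₁, _, rfl, h1, S₂, S₃, rfl, h2, h3⟩
      exact ⟨S₁ ++ S₂, S₃, by simp, ⟨S₁, S₂, rfl, h1, h2⟩, by simpa using h3⟩
    · rintro ⟨_, S₃, rfl, ⟨S₁, S₂, rfl, h1, h2⟩, h3⟩
      exact ⟨S₁, S₂ ++ S₃, by simp, h1, S₂, S₃, rfl, h2, by simpa using h3⟩

/-- The instructions can be carried out from the positions `pos`, and however this is done, the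
moves are legal and `Q` holds for the final positions and the moves. -/
def Carries (pos : List V) (L : List (Instr V)) (Q : List V → List (Move V) → Prop) : Prop :=
  (∃ S, T.Expands pos L S) ∧
    ∀ S, T.Expands pos L S → T.LegalFrom pos S ∧ Q (S.foldl T.after pos) S

variable {T}

theorem Carries.mono {pos : List V} {L : List (Instr V)} {Q Q' : List V → List (Move V) → Prop}
    (h : T.Carries pos L Q) (hQ : ∀ p S, Q p S → Q' p S) : T.Carries pos L Q' :=
  ⟨h.1, fun S hS => ⟨(h.2 S hS).1, hQ _ _ (h.2 S hS).2⟩⟩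

theorem Carries.append {pos : List V} {L L' : List (Instr V)}
    {Q Q' : List V → List (Move V) → Prop} (h : T.Carries pos L Q)
    (h' : ∀ p S, Q p S → T.Carries p L' fun p' S' => Q' p' (S ++ S')) :
    T.Carries pos (L ++ L') Q' := by
  obtain ⟨⟨S, hS⟩, h⟩ := h
  refine ⟨?_, fun S₀ hS₀ => ?_⟩
  · obtain ⟨S', hS'⟩ := (h' _ _ (h S hS).2).1
    exact ⟨S ++ S', (T.expands_append _ _ _ _).2 ⟨S, S', rfl, hS, hS'⟩⟩
  · obtain ⟨S₁, S₂, rfl, h1, h2⟩ := (T.expands_append _ _ _ _).1 hS₀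
    obtain ⟨h3, h4⟩ := h S₁ h1
    obtain ⟨h5, h6⟩ := (h' _ _ h4).2 S₂ h2
    exact ⟨(T.legalFrom_append _ _ _).2 ⟨h3, h5⟩, by simpa using h6⟩

theorem Carries.nil {pos : List V} {Q : List V → List (Move V) → Prop} (h : Q pos []) :
    T.Carries pos [] Q :=
  ⟨⟨[], rfl⟩, fun S hS => by cases hS; exact ⟨trivial, h⟩⟩

theorem expands_singleton {pos : List V} {I : Instr V} {S : List (Move V)} :
    T.Expands pos [I] S ↔ T.ExpandsInstr pos I S := by
  simp only [Expands]
  constructor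
  · rintro ⟨S₁, S₂, rfl, h, rfl⟩
    simpa using h
  · exact fun h => ⟨S, [], by simp, h, rfl⟩

theorem Carries.singleton {pos : List V} {I : Instr V} {Q : List V → List (Move V) → Prop}
    (h : ∃ S, T.ExpandsInstr pos I S)
    (h' : ∀ S, T.ExpandsInstr pos I S → T.LegalFrom pos S ∧ Q (S.foldl T.after pos) S) :
    T.Carries pos [I] Q := by
  simpa only [Carries, expands_singleton] using ⟨h, h'⟩

variable [DecidableEq V]

/-- The effect of a move on the numbers of agents at the vertices. -/
theorem count_set_add {pos : List V} {i : ℕ} {u v : V} (h : pos[i]? = some u) (x : V) :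
    (pos.set i v).count x + (if x = u then 1 else 0) = pos.count x + if x = v then 1 else 0 := by
  obtain ⟨hi, h⟩ := List.getElem?_eq_some_iff.1 h
  rw [List.count_set hi, h]
  have : x = u → 1 ≤ pos.count x := by
    rintro rfl
    exact List.one_le_count_iff.2 (h ▸ List.getElem_mem hi)
  simp only [beq_iff_eq]
  split_ifs <;> grind

theorem count_eq_countP_range (pos : List V) (u : V) :
    pos.count u = (List.range pos.length).countP fun i => pos[i]? = some u := by
  induction pos using List.reverseRecOn with
  | nil => rfl
  | append_singleton l a ih =>
    have h : (List.range l.length).countP (fun i => (l ++ [a])[i]? = some u) =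
        (List.range l.length).countP (fun i => l[i]? = some u) :=
      List.countP_congr fun i hi => by
        rw [List.getElem?_append_left (List.mem_range.1 hi)]
    rw [List.length_append, List.length_singleton, List.range_succ, List.countP_append,
      List.count_append, ih, h]
    simp [List.count_singleton]

theorem exists_agents {pos : List V} {u : V} {m : ℕ} (h : m ≤ pos.count u) :
    ∃ A : List ℕ, A.Nodup ∧ A.length = m ∧ ∀ i ∈ A, pos[i]? = some u := by
  refine ⟨((List.range pos.length).filter fun i => pos[i]? = some u).take m,
    (List.nodup_range.filter _).take, ?_, fun i hi => ?_⟩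
  · rw [List.length_take, min_eq_left]
    refine h.trans (le_of_eq ?_)
    rw [← List.countP_eq_length_filter, count_eq_countP_range]
  · simpa using (List.mem_filter.1 (List.mem_of_mem_take hi)).2

theorem moves_traverse {pos : List V} {u v : V} (huv : T.graph.Adj u v) {A : List ℕ}
    (hA : A.Nodup) (hpos : ∀ i ∈ A, pos[i]? = some u) :
    T.LegalFrom pos (A.map fun i => Move.traverse i u v) ∧
    (∀ x, ((A.map fun i => Move.traverse i u v).foldl T.after pos).count x +
      (if x = u then A.length else 0) = pos.count x + if x = v then A.length else 0) ∧
    numAgents (A.map fun i => Move.traverse i u v) = 0 ∧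
    T.travel (A.map fun i => Move.traverse i u v) = A.length * T.weight s(u, v) := by
  induction A generalizing pos with
  | nil => simp [LegalFrom]
  | cons i A ih =>
    rw [List.nodup_cons] at hA
    obtain ⟨h1, h2, h3, h4⟩ := ih (pos := pos.set i v) hA.2 fun j hj => by
      rw [List.getElem?_set_ne (by rintro rfl; exact hA.1 hj)]
      exact hpos j (List.mem_cons_of_mem _ hj)
    have h5 := hpos i List.mem_cons_self
    refine ⟨⟨⟨h5, huv⟩, h1⟩, fun x => ?_, ?_, ?_⟩
    · have h6 := h2 x
      have h7 := count_set_add (v := v) h5 x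
      simp only [List.map_cons, List.foldl_cons, after, List.length_cons]
      split_ifs at h6 h7 ⊢ <;> omega
    · simpa [numAgents, Move.invocations] using h3
    · simp only [travel, List.map_cons, List.sum_cons, List.length_cons] at h4 ⊢
      rw [h4]
      push_cast
      ring

theorem carries_traverse {pos : List V} {u v : V} (huv : T.graph.Adj u v) {m : ℕ}
    (hm : m ≤ pos.count u) (hm1 : 1 ≤ m) :
    T.Carries pos [Instr.traverse u v m] fun p S =>
      (∀ x, p.count x + (if x = u then m else 0) = pos.count x + if x = v then m else 0) ∧
      numAgents S = 0 ∧ T.travel S = m * T.weight s(u, v) ∧ ∃ a ∈ S, T.reached a = v := by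
  refine Carries.singleton ?_ ?_
  · obtain ⟨A, h1, h2, h3⟩ := exists_agents hm
    exact ⟨_, A, h1, h2, h3, rfl⟩
  · rintro S ⟨A, h1, rfl, h3, rfl⟩
    obtain ⟨h4, h5⟩ := moves_traverse huv h1 h3
    refine ⟨h4, h5.1, h5.2.1, h5.2.2, ?_⟩
    obtain ⟨i, hi⟩ := List.exists_mem_of_length_pos hm1
    exact ⟨_, List.mem_map.2 ⟨i, hi, rfl⟩, rfl⟩

theorem moves_walk {pos : List V} {i : ℕ} {x y : V} (p : T.graph.Walk x y)
    (hpos : pos[i]? = some x) :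
    T.LegalFrom pos (p.darts.map fun d => Move.traverse i d.fst d.snd) ∧
    (p.darts.map fun d => Move.traverse i d.fst d.snd).foldl T.after pos = pos.set i y ∧
    numAgents (p.darts.map fun d => Move.traverse i d.fst d.snd) = 0 ∧
    T.travel (p.darts.map fun d => Move.traverse i d.fst d.snd) =
      (p.edges.map T.weight).sum := by
  induction p generalizing pos with
  | nil =>
    obtain ⟨hi, h⟩ := List.getElem?_eq_some_iff.1 hpos
    simp [LegalFrom, ← h]
  | cons h p ih =>
    obtain ⟨hi, -⟩ := List.getElem?_eq_some_iff.1 hpos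
    obtain ⟨h1, h2, h3, h4⟩ := ih (pos := pos.set i _) (List.getElem?_set_self hi)
    refine ⟨⟨⟨hpos, h⟩, h1⟩, ?_, ?_, ?_⟩
    · simpa [after] using h2
    · simpa [numAgents, Move.invocations] using h3
    · simpa [travel] using h4

variable [Fintype V]

theorem exists_path_up {v x : V} (h : x ∈ T.descendants v) : ∃ p : T.graph.Walk x v,
    p.length + T.graph.dist T.root v = T.graph.dist T.root x ∧
    (p.edges.map T.weight).sum = T.depth x - T.depth v := by
  induction v using T.child_induction with
  | _ v ih =>
    rcases T.mem_descendants.1 h with rfl | ⟨u, hu, hx⟩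
    · exact ⟨.nil, by simp⟩
    · obtain ⟨p, h1, h2⟩ := ih u hu hx
      refine ⟨p.concat (T.adj_child hu).symm, ?_, ?_⟩
      · rw [SimpleGraph.Walk.length_concat, ← h1, T.dist_child hu]
        ring
      · rw [SimpleGraph.Walk.edges_concat, List.concat_eq_append, List.map_append, List.sum_append,
          h2, T.depth_child hu, T.parentWeight_child hu, Sym2.eq_swap]
        simp
        ring

/-- The length equals the difference of the distances from the root, so by the triangle inequality
no walk is shorter. -/
theorem path_up_isPath {v x : V} (p : T.graph.Walk x v)
    (h : p.length + T.graph.dist T.root v = T.graph.dist T.root x) : p.IsPath := by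
  refine p.isPath_of_length_eq_dist (le_antisymm ?_ (SimpleGraph.dist_le p))
  have := T.isTree.connected.dist_triangle (u := T.root) (v := v) (w := x)
  rw [SimpleGraph.dist_comm (u := x)]
  omega

theorem carries_sendBack {pos : List V} {v x : V} (hx : x ∈ T.descendants v)
    (hc : x ∈ pos) :
    T.Carries pos [Instr.sendBack x v] fun p S =>
      (∀ y, p.count y + (if y = x then 1 else 0) = pos.count y + if y = v then 1 else 0) ∧
      numAgents S = 0 ∧ T.travel S = T.depth x - T.depth v := by
  obtain ⟨p, h1, h2⟩ := exists_path_up hx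
  have hp := path_up_isPath p h1
  refine Carries.singleton ?_ ?_
  · obtain ⟨i, hi⟩ := List.mem_iff_getElem?.1 hc
    exact ⟨_, i, p, hi, hp, rfl⟩
  · rintro S ⟨i, p', hi, hp', rfl⟩
    -- Uniqueness of paths in a tree identifies the path chosen in the expansion with the ascending
    -- one, whose length is known.
    obtain rfl := (T.isTree.existsUnique_path x v).unique hp hp'
    obtain ⟨h3, h4, h5, h6⟩ := moves_walk p hi
    exact ⟨h3, by rw [h4]; exact count_set_add hi, h5, h6.trans h2⟩

end WeightedTree

namespace WeightedTree

variable {V : Type} (T : WeightedTree V) [Fintype V] [DecidableEq V]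

/-! ## The moves described by the computed list of instructions -/

/-- The agents for the exploration of the subtree at `v` have arrived. -/
def Ready (q : ℝ) (v : V) (pos : List V) : Prop :=
  pos.count v = (T.label q v).k ∧ ∀ x ∈ T.descendants v, x ≠ v → pos.count x = 0

/-- The effect of the exploration of the subtree at `v` by the agents that have arrived. -/
structure Explored (q : ℝ) (v : V) (pos p : List V) (S : List (Move V)) : Prop where
  count_of_not_mem : ∀ x, x ∉ T.descendants v → p.count x = pos.count x
  count_of_mem : T.height q v ≤ T.depth v + q →
    ∀ x ∈ T.descendants v, p.count x = if x = (T.label q v).ul then 1 else 0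
  numAgents_eq : numAgents S = 0
  travel_eq : T.travel S = T.serve q v - (T.label q v).k * (T.depth v + q)
  visited : ∀ x ∈ T.descendants v, x ≠ v → ∃ m ∈ S, T.reached m = x

variable {T} {q : ℝ}

theorem carries_enter {v u : V} (hu : u ∈ T.children v)
    (ih : ∀ pos, T.Ready q u pos → T.Carries pos (T.program q u) (T.Explored q u pos))
    {pos : List V} (hk : (T.label q u).k ≤ pos.count v)
    (h0 : ∀ x ∈ T.descendants u, pos.count x = 0) :
    T.Carries pos (T.enter q v u) fun p S =>
      (∀ x, x ∉ T.descendants u →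
        p.count x + (if x = v then (T.label q u).k else 0) = pos.count x) ∧
      (T.height q u ≤ T.depth u + q →
        ∀ x ∈ T.descendants u, p.count x = if x = (T.label q u).ul then 1 else 0) ∧
      numAgents S = 0 ∧ T.travel S = T.serve q u - (T.label q u).k * (T.depth v + q) ∧
      ∀ x ∈ T.descendants u, ∃ m ∈ S, T.reached m = x := by
  refine Carries.append (L := [_])
    (carries_traverse (T.adj_child hu) hk (T.label_k_pos q u)) ?_
  rintro p S ⟨hc, hn, ht, hr⟩
  have huv := T.child_ne hu
  refine (ih p ⟨?_, fun x hx hxu => ?_⟩).mono fun p' S' h => ⟨fun x hx => ?_, h.count_of_mem,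
    ?_, ?_, fun x hx => ?_⟩
  · simpa [huv, h0 u (T.mem_descendants_self u)] using hc u
  · have hxv : x ≠ v := by rintro rfl; exact T.not_mem_descendants_child hu hx
    simpa [hxu, hxv, h0 x hx] using hc x
  · have hxu : x ≠ u := by rintro rfl; exact hx (T.mem_descendants_self x)
    rw [h.count_of_not_mem x hx]
    simpa [hxu] using hc x
  · rw [numAgents_append, hn, h.numAgents_eq]
  · rw [travel_append, ht, h.travel_eq, T.depth_child hu, T.parentWeight_child hu]
    ring
  · by_cases hxu : x = u
    · obtain ⟨m, hm, h⟩ := hr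
      exact ⟨m, List.mem_append_left _ hm, h.trans hxu.symm⟩
    · obtain ⟨m, hm, h⟩ := h.visited x hx hxu
      exact ⟨m, List.mem_append_right _ hm, h⟩

/-- If `u` is near, one agent goes down and must be found at `(T.label q u).ul` to be sent back;
this is why `Explored` fixes the final positions in the case of small height. In the other case
nobody leaves the subtree, and the final positions are irrelevant. -/
theorem carries_visit {v u : V} (hu : u ∈ T.children v)
    (ih : ∀ pos, T.Ready q u pos → T.Carries pos (T.program q u) (T.Explored q u pos))
    {pos : List V} (hk : T.staying q u + 1 ≤ pos.count v)
    (h0 : ∀ x ∈ T.descendants u, pos.count x = 0) :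
    T.Carries pos (T.visit q v u) fun p S =>
      (∀ x, x ∉ T.descendants u →
        p.count x + (if x = v then T.staying q u else 0) = pos.count x) ∧
      (T.Near q u → ∀ x ∈ T.descendants u, p.count x = 0) ∧
      numAgents S = 0 ∧ T.travel S = T.detour q u - T.staying q u * (T.depth v + q) ∧
      ∀ x ∈ T.descendants u, ∃ m ∈ S, T.reached m = x := by
  by_cases hn : T.Near q u
  · have hk1 := T.near_label_k q hn
    have hh := T.height_le_of_near hn
    rw [T.staying_near hn] at hk ⊢
    rw [visit, if_pos hn]
    refine Carries.append (carries_enter hu ih (by omega) h0) ?_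
    rintro p S ⟨hc, hm, hS, ht, hr⟩
    have hul := T.label_ul_mem q u
    have hcu : p.count (T.label q u).ul = 1 := by simpa using hm hh _ hul
    refine (carries_sendBack (T.mem_descendants_of_child hu hul)
      (List.count_pos_iff.1 (by omega))).mono ?_
    rintro p' S' ⟨hc', hS', ht'⟩
    refine ⟨fun x hx => ?_, fun _ x hx => ?_, ?_, ?_, fun x hx => ?_⟩
    · have h1 := hc x hx
      have h2 := hc' x
      have h3 : x ≠ (T.label q u).ul := by rintro rfl; exact hx hul
      rw [hk1] at h1
      simp only [h3, if_false] at h2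
      split_ifs at h1 h2 ⊢ <;> omega
    · have h1 := hm hh x hx
      have h2 := hc' x
      have h3 : x ≠ v := by rintro rfl; exact T.not_mem_descendants_child hu hx
      simp only [h3, if_false] at h2
      omega
    · rw [numAgents_append, hS, hS']
    · rw [travel_append, ht, ht', hk1, T.serve_of_height_le hh, T.detour_near hn, height,
        T.depth_child hu]
      push_cast
      ring
    · obtain ⟨m, hm, h⟩ := hr x hx
      exact ⟨m, List.mem_append_left _ hm, h⟩
  · rw [T.staying_not_near hn] at hk ⊢
    rw [visit, if_neg hn, List.append_nil]
    refine (carries_enter hu ih (by omega) h0).mono ?_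
    rintro p S ⟨hc, hm, hS, ht, hr⟩
    exact ⟨hc, fun h => absurd h hn, hS, by rw [ht, T.detour_not_near hn], hr⟩

/-- The `+ 1` in `hk` is an agent kept for the child handled last; it ensures that each near child
finds an agent at `v`, and it is again available after each return. -/
theorem carries_visits {v : V} {l : List V} (hl : l ⊆ T.children v) (hnd : l.Nodup)
    (ih : ∀ u ∈ T.children v, ∀ pos, T.Ready q u pos →
      T.Carries pos (T.program q u) (T.Explored q u pos))
    {pos : List V} (hk : (l.map (T.staying q)).sum + 1 ≤ pos.count v)
    (h0 : ∀ u ∈ l, ∀ x ∈ T.descendants u, pos.count x = 0) :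
    T.Carries pos (l.flatMap (T.visit q v)) fun p S =>
      (∀ x, (∀ u ∈ l, x ∉ T.descendants u) →
        p.count x + (if x = v then (l.map (T.staying q)).sum else 0) = pos.count x) ∧
      (∀ u ∈ l, T.Near q u → ∀ x ∈ T.descendants u, p.count x = 0) ∧
      numAgents S = 0 ∧
      T.travel S = (l.map (T.detour q)).sum - (l.map (T.staying q)).sum * (T.depth v + q) ∧
      ∀ u ∈ l, ∀ x ∈ T.descendants u, ∃ m ∈ S, T.reached m = x := by
  induction l generalizing pos with
  | nil => exact Carries.nil (by simp)
  | cons u l ihl =>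
    have hu : u ∈ T.children v := hl List.mem_cons_self
    have hl' : l ⊆ T.children v := fun x hx => hl (List.mem_cons_of_mem _ hx)
    rw [List.nodup_cons] at hnd
    rw [List.map_cons, List.sum_cons] at hk
    have hdisj : ∀ u' ∈ l, ∀ x ∈ T.descendants u', x ∉ T.descendants u := fun u' hu' x hx hx' =>
      hnd.1 (T.eq_of_mem_descendants_children hu (hl' hu') hx' hx ▸ hu')
    rw [List.flatMap_cons]
    refine Carries.append (carries_visit hu (ih u hu) (by omega) (h0 u List.mem_cons_self)) ?_
    rintro p S ⟨hc, hm, hS, ht, hr⟩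
    refine (ihl hl' hnd.2 (pos := p) ?_ ?_).mono ?_
    · have := hc v (T.not_mem_descendants_child hu)
      rw [if_pos rfl] at this
      omega
    · intro u' hu' x hx
      have := hc x (hdisj u' hu' x hx)
      have := h0 u' (List.mem_cons_of_mem _ hu') x hx
      omega
    · rintro p' S' ⟨hc', hm', hS', ht', hr'⟩
      refine ⟨fun x hx => ?_, ?_, ?_, ?_, ?_⟩
      · have h1 := hc x (hx u List.mem_cons_self)
        have h2 := hc' x fun u' hu' => hx u' (List.mem_cons_of_mem _ hu')
        rw [List.map_cons, List.sum_cons]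
        split_ifs at h1 h2 ⊢ <;> omega
      · rw [List.forall_mem_cons]
        refine ⟨fun hn x hx => ?_, hm'⟩
        have h1 := hm hn x hx
        have h2 := hc' x fun u' hu' hx' => hdisj u' hu' x hx' hx
        omega
      · rw [numAgents_append, hS, hS']
      · rw [travel_append, ht, ht']
        push_cast [List.map_cons, List.sum_cons]
        ring
      · rw [List.forall_mem_cons]
        refine ⟨fun x hx => ?_, fun u' hu' x hx => ?_⟩
        · obtain ⟨m, hm, h⟩ := hr x hx
          exact ⟨m, List.mem_append_left _ hm, h⟩
        · obtain ⟨m, hm, h⟩ := hr' u' hu' x hx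
          exact ⟨m, List.mem_append_right _ hm, h⟩

theorem carries_node {v w : V} (hw : w ∈ T.children v)
    (hul : (T.label q v).ul = (T.label q w).ul)
    (hh : T.height q v = T.parentWeight w + T.height q w)
    (ih : ∀ u ∈ T.children v, ∀ pos, T.Ready q u pos →
      T.Carries pos (T.program q u) (T.Explored q u pos))
    {pos : List V} (hpos : T.Ready q v pos) :
    T.Carries pos (((T.children v).erase w).flatMap (T.visit q v) ++ T.enter q v w)
      (T.Explored q v pos) := by
  have hnd := T.children_nodup v
  have hsub : (T.children v).erase w ⊆ T.children v := List.erase_subset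
  have hk := T.label_k_last hw hh
  have hk1 := T.label_k_pos q w
  have h0 : ∀ u ∈ T.children v, ∀ x ∈ T.descendants u, pos.count x = 0 := fun u hu x hx =>
    hpos.2 x (T.mem_descendants_of_child hu hx)
      (by rintro rfl; exact T.not_mem_descendants_child hu hx)
  have hmem : ∀ u, u ∈ T.children v ↔ u = w ∨ u ∈ (T.children v).erase w := fun u => by
    rw [hnd.mem_erase_iff]
    by_cases h : u = w
    · simp [h, hw]
    · simp [h]
  have hdisj : ∀ u ∈ (T.children v).erase w, ∀ x ∈ T.descendants u, x ∉ T.descendants w :=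
    fun u hu x hx hx' => (hnd.mem_erase_iff.1 hu).1
      (T.eq_of_mem_descendants_children (hsub hu) hw hx hx')
  refine Carries.append (carries_visits hsub (hnd.erase w) ih
    (by rw [hpos.1]; omega) fun u hu => h0 u (hsub hu)) ?_
  rintro p S ⟨hc, hm, hS, ht, hr⟩
  have hpv := hc v fun u hu => T.not_mem_descendants_child (hsub hu)
  rw [if_pos rfl, hpos.1] at hpv
  refine (carries_enter hw (ih w hw) (by omega) fun x hx => ?_).mono ?_
  · have h1 := hc x fun u hu hx' => hdisj u hu x hx' hx
    have h2 := h0 w hw x hx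
    omega
  rintro p' S' ⟨hc', hm', hS', ht', hr'⟩
  constructor
  · intro x hx
    have hxv : x ≠ v := by rintro rfl; exact hx (T.mem_descendants_self x)
    have h1 := hc x fun u hu hx' => hx (T.mem_descendants_of_child (hsub hu) hx')
    have h2 := hc' x fun hx' => hx (T.mem_descendants_of_child hw hx')
    rw [if_neg hxv] at h1 h2
    omega
  · intro hle x hx
    have hulw := T.label_ul_mem q w
    rw [hul]
    by_cases hxw : x ∈ T.descendants w
    · exact hm' (T.height_le_of_near (T.near_child hle hw)) x hxw
    · have hne : x ≠ (T.label q w).ul := by rintro rfl; exact hxw hulw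
      have h2 := hc' x hxw
      rw [if_neg hne]
      rcases T.mem_descendants.1 hx with rfl | ⟨u, hu, hxu⟩
      · rw [if_pos rfl] at h2
        omega
      · rcases (hmem u).1 hu with rfl | hu'
        · exact absurd hxu hxw
        · have := hm u hu' (T.near_child hle hu) x hxu
          omega
  · rw [numAgents_append, hS, hS']
  · have hperm := ((List.perm_cons_erase hw).map (T.detour q)).sum_eq
    rw [List.map_cons, List.sum_cons] at hperm
    rw [travel_append, ht, ht', hk, T.serve_last hw hh, serve, hperm]
    push_cast
    ring
  · intro x hx hxv
    rcases T.mem_descendants.1 hx with rfl | ⟨u, hu, hxu⟩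
    · exact absurd rfl hxv
    · rcases (hmem u).1 hu with rfl | hu'
      · obtain ⟨m, hm, h⟩ := hr' x hxu
        exact ⟨m, List.mem_append_right _ hm, h⟩
      · obtain ⟨m, hm, h⟩ := hr u hu' x hxu
        exact ⟨m, List.mem_append_left _ hm, h⟩

theorem carries_program (hq : 0 ≤ q) {v : V} (hv : v ≠ T.root) {pos : List V}
    (hpos : T.Ready q v pos) : T.Carries pos (T.program q v) (T.Explored q v pos) := by
  induction v using T.child_induction generalizing pos with
  | _ v ih =>
    by_cases h : T.children v = []
    · rw [T.program_leaf q h]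
      have hd : ∀ x, x ∈ T.descendants v ↔ x = v := fun x => by simp [T.descendants_leaf h]
      refine Carries.nil ⟨fun _ _ => rfl, fun _ x hx => ?_, rfl, ?_, fun x hx hxv => ?_⟩
      · rw [(hd x).1 hx, hpos.1, T.label_leaf q h]
        simp
      · have := T.depth_nonneg v
        simp only [serve, height, T.label_leaf q h, h, sub_self, sub_zero]
        -- Here `0 ≤ q` is needed: the price `depth v + q` of the agent at a leaf is not cut off at
        -- 0.
        rw [max_eq_right (by linarith)]
        simp
      · exact absurd ((hd x).1 hx) hxv
    · obtain ⟨w, hw, huc, hul, hh, -⟩ := T.label_uc q h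
      rw [T.program_node q hw huc, if_neg hv, List.nil_append]
      exact carries_node hw hul hh (fun u hu _ => ih u hu (T.child_ne_root hu)) hpos

theorem carries_invoke (m : ℕ) :
    T.Carries [] [Instr.invoke m] fun p S => p = List.replicate m T.root ∧ numAgents S = m ∧
      T.travel S = 0 ∧ (1 ≤ m → ∃ a ∈ S, T.reached a = T.root) := by
  have key : ∀ pos, T.LegalFrom pos (List.replicate m Move.invoke) ∧
      (List.replicate m Move.invoke).foldl T.after pos = pos ++ List.replicate m T.root := by
    induction m with
    | zero => simp [LegalFrom]
    | succ m ih =>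
      intro pos
      obtain ⟨h1, h2⟩ := ih (pos ++ [T.root])
      exact ⟨⟨trivial, h1⟩, by simp [List.replicate_succ, after, h2]⟩
  refine Carries.singleton ⟨_, rfl⟩ ?_
  rintro S rfl
  refine ⟨(key []).1, (key []).2, ?_, ?_, fun hm => ⟨Move.invoke, ?_, rfl⟩⟩
  · simp [numAgents, Move.invocations]
  · simp [travel]
  · simp only [List.mem_replicate, and_true]
    omega

theorem carries_program_root (hq : 0 ≤ q) (hcard : 2 ≤ Fintype.card V) :
    T.Carries [] (T.program q T.root) fun _ S =>
      numAgents S = (T.label q T.root).k ∧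
      T.travel S = T.serve q T.root - (T.label q T.root).k * q ∧ T.Explores S := by
  -- With a single vertex the root would be a leaf, and the procedure would return before invoking
  -- any agent; at least two vertices rule this out.
  have h : T.children T.root ≠ [] := by
    intro h
    have : ∀ x, x = T.root := fun x => by
      simpa [T.descendants_leaf h] using T.mem_descendants_root x
    have := Fintype.card_le_one_iff.2 fun a b => (this a).trans (this b).symm
    omega
  obtain ⟨w, hw, huc, hul, hh, -⟩ := T.label_uc q h
  rw [T.program_node q hw huc, if_pos rfl]
  refine Carries.append (carries_invoke _) ?_
  rintro p S ⟨rfl, hn, ht, hr⟩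
  refine (carries_node hw hul hh (fun u hu _ => carries_program hq (T.child_ne_root hu)) ?_).mono ?_
  · refine ⟨List.count_replicate_self, fun x _ hx => ?_⟩
    rw [List.count_replicate]
    simp [hx.symm]
  · intro p' S' h
    refine ⟨?_, ?_, fun x => ?_⟩
    · rw [numAgents_append, hn, h.numAgents_eq, add_zero]
    · rw [travel_append, ht, h.travel_eq, T.depth_root]
      ring
    · by_cases hx : x = T.root
      · obtain ⟨m, hm, h⟩ := hr (T.label_k_pos q _)
        exact ⟨m, List.mem_append_left _ hm, h.trans hx.symm⟩
      · obtain ⟨m, hm, h⟩ := h.visited x (T.mem_descendants_root x) hx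
        exact ⟨m, List.mem_append_right _ hm, h⟩

end WeightedTree

namespace WeightedTree

variable {V : Type} (T : WeightedTree V)

/-! ## The cost as a sum over the edges -/

theorem index_lt_of_mem {pos : List V} {S : List (Move V)} (h : T.LegalFrom pos S) {i : ℕ} {u v : V}
    (hm : Move.traverse i u v ∈ S) : i < pos.length + numAgents S := by
  induction S generalizing pos with
  | nil => simp at hm
  | cons m S ih =>
    rcases List.mem_cons.1 hm with rfl | hm'
    · exact Nat.lt_add_right _ (List.getElem?_eq_some_iff.1 h.1.1).1
    · have h1 := ih h.2 hm'
      cases m <;> simp [after, numAgents, Move.invocations] at h1 ⊢ <;> omega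

/-- Each traversal is charged to exactly one agent of the range, so the distinction between agents
disappears from the cost. -/
theorem sum_agentDistance {S : List (Move V)} {N : ℕ}
    (h : ∀ i u v, Move.traverse i u v ∈ S → i < N) :
    ∑ i ∈ Finset.range N, T.agentDistance S i = T.travel S := by
  induction S with
  | nil => simp [agentDistance, travel]
  | cons m S ih =>
    have h1 := ih fun i u v hm => h i u v (List.mem_cons_of_mem _ hm)
    simp only [agentDistance, travel, List.map_cons, List.sum_cons, Finset.sum_add_distrib] at h1 ⊢
    rw [h1]
    congr 1
    cases m with
    | invoke => simp [moveLength]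
    | traverse i u v =>
      have := h i u v List.mem_cons_self
      simp [moveLength, this]

theorem cost_eq (q : ℝ) {S : List (Move V)} (h : T.IsStrategy S) :
    T.cost q S = numAgents S * q + T.travel S := by
  rw [cost, T.sum_agentDistance fun i u v hm => ?_]
  simpa using T.index_lt_of_mem h hm

variable [Fintype V] [DecidableEq V]

/-- The number of agents below `c`. -/
def occupancy (c : V) (pos : List V) : ℕ := T.subtreeSum (fun x => pos.count x) c

/-- The number of times that the edge from `c` to its parent is traversed in a move. -/
def crossing (c : V) : Move V → ℕ
  | .invoke => 0
  | .traverse _ u v => if u ∈ T.descendants c ↔ v ∈ T.descendants c then 0 else 1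

/-- The number of times that the edge from `c` to its parent is traversed. -/
def crossings (c : V) (S : List (Move V)) : ℕ := (S.map (T.crossing c)).sum

theorem subtreeSum_indicator (c u : V) :
    T.subtreeSum (fun x => if x = u then 1 else 0) c = if u ∈ T.descendants c then 1 else 0 := by
  have h : T.subtreeSum (fun x => if x = u then 1 else 0) c = (T.descendants c).count u := by
    rw [subtreeSum]
    induction T.descendants c with
    | nil => rfl
    | cons a l ih => simp [List.count_cons, ih, add_comm]
  rw [h, (T.nodup_descendants c).count]

theorem subtreeSum_add {M : Type} [AddCommMonoid M] (f g : V → M) (c : V) :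
    T.subtreeSum (fun x => f x + g x) c = T.subtreeSum f c + T.subtreeSum g c :=
  List.sum_map_add

theorem occupancy_set {pos : List V} {i : ℕ} {u v : V} (h : pos[i]? = some u) (c : V) :
    T.occupancy c (pos.set i v) + (if u ∈ T.descendants c then 1 else 0) =
      T.occupancy c pos + if v ∈ T.descendants c then 1 else 0 := by
  simp only [occupancy, ← subtreeSum_indicator, ← subtreeSum_add]
  congr 1
  funext x
  exact count_set_add h x

theorem occupancy_root (pos : List V) : T.occupancy T.root pos = pos.length := by
  rw [occupancy, subtreeSum_root]
  induction pos with
  | nil => simp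
  | cons a l ih => simp [List.count_cons, Finset.sum_add_distrib, ih]

theorem root_not_mem_descendants {c : V} (hc : c ≠ T.root) : T.root ∉ T.descendants c := by
  intro h
  have := T.dist_lt_of_mem_descendants h hc.symm
  simp at this

theorem occupancy_after_invoke {c : V} (hc : c ≠ T.root) (pos : List V) :
    T.occupancy c (T.after pos .invoke) = T.occupancy c pos := by
  rw [occupancy, occupancy, subtreeSum, subtreeSum]
  congr 1
  refine List.map_congr_left fun x hx => ?_
  have : T.root ≠ x := by rintro rfl; exact T.root_not_mem_descendants hc hx
  simp [after, List.count_append, this]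

/-- The number of agents below `c` changes only when the edge above `c` is crossed, and then by one.
The root is excluded because invocations change its count. -/
theorem crossings_spec {c : V} (hc : c ≠ T.root) {pos : List V} {S : List (Move V)}
    (h : T.LegalFrom pos S) :
    T.occupancy c (S.foldl T.after pos) ≤ T.occupancy c pos + T.crossings c S ∧
    Even (T.occupancy c (S.foldl T.after pos) + T.occupancy c pos + T.crossings c S) ∧
    ((∃ m ∈ S, T.reached m ∈ T.descendants c) → 1 ≤ T.occupancy c pos + T.crossings c S) := by
  induction S generalizing pos with
  | nil => simp [crossings]
  | cons m S ih =>
    obtain ⟨h1, h2, h3⟩ := ih h.2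
    simp only [crossings, List.map_cons, List.sum_cons, List.foldl_cons, List.mem_cons,
      exists_eq_or_imp] at h1 h2 h3 ⊢
    cases m with
    | invoke =>
      rw [T.occupancy_after_invoke hc] at h1 h2 h3
      simp only [crossing, zero_add, reached, T.root_not_mem_descendants hc, false_or]
      exact ⟨h1, h2, h3⟩
    | traverse i u v =>
      have h4 := T.occupancy_set (v := v) h.1.1 c
      have h5 : u ∈ T.descendants c → 1 ≤ T.occupancy c pos := fun hu => by
        -- Imagining the agent moved out to the root shows that it was counted below `c`.
        have h6 := T.occupancy_set (v := T.root) h.1.1 c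
        rw [if_pos hu, if_neg (T.root_not_mem_descendants hc)] at h6
        omega
      simp only [after, crossing, reached] at h1 h2 h3 h4 ⊢
      rw [Nat.even_iff] at h2 ⊢
      by_cases hu : u ∈ T.descendants c <;> by_cases hv : v ∈ T.descendants c <;>
        simp only [hu, hv, iff_true, iff_false, not_true, if_true, if_false,
          true_or, false_or, forall_const] at h3 h4 h5 ⊢ <;>
        refine ⟨by omega, by omega, ?_⟩ <;> intros <;> first | omega | (have := h3 ‹_›; omega)

/-- Only the lower endpoint `c` of the traversed edge has exactly one of the two endpoints below it.
-/
theorem sum_crossing {u v : V} (h : T.graph.Adj u v) (i : ℕ) :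
    ∑ c, T.parentWeight c * T.crossing c (Move.traverse i u v) = T.weight s(u, v) := by
  have key : ∀ u v : V, v ∈ T.children u → ∀ c,
      (u ∈ T.descendants c ↔ v ∈ T.descendants c) ↔ c ≠ v := by
    intro u v hv c
    constructor
    · rintro h rfl
      exact T.not_mem_descendants_child hv (h.2 (T.mem_descendants_self c))
    · exact fun hc => ⟨fun h => T.child_mem_descendants h hv,
        fun h => T.parent_mem_descendants h hc.symm hv⟩
  rcases T.child_or_child_of_adj h with h | h
  · simp only [crossing, key u v h]
    simp [T.parentWeight_child h]
  · simp only [crossing, Iff.comm (a := u ∈ _), key v u h]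
    simp [T.parentWeight_child h, Sym2.eq_swap]

theorem travel_eq_sum {pos : List V} {S : List (Move V)} (h : T.LegalFrom pos S) :
    T.travel S = ∑ c, T.parentWeight c * T.crossings c S := by
  induction S generalizing pos with
  | nil => simp [crossings]
  | cons m S ih =>
    have h1 := ih h.2
    have h2 : T.travel (m :: S) = T.travel [m] + T.travel S := T.travel_append [m] S
    rw [h2, h1]
    simp only [crossings, List.map_cons, List.sum_cons, Nat.cast_add, mul_add,
      Finset.sum_add_distrib]
    congr 1
    cases m with
    | invoke => simp [travel, crossing]
    | traverse i u v =>
      rw [T.sum_crossing h.1.2]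
      simp [travel]

/-! ## The lower bound -/

/-- The least number of traversals of an edge below which `n` agents stay. -/
def leastCrossings (n : ℕ) : ℕ := if n = 0 then 2 else n

/-- Starting without agents, the number of crossings is positive and has the parity of the final
occupancy; if that is 0, the crossings number at least two. -/
theorem leastCrossings_le {S : List (Move V)} (h : T.IsStrategy S) (hS : T.Explores S) {c : V}
    (hc : c ≠ T.root) :
    leastCrossings (T.occupancy c (S.foldl T.after [])) ≤ T.crossings c S := by
  obtain ⟨h1, h2, h3⟩ := T.crossings_spec hc h
  have h0 : T.occupancy c [] = 0 := by simp [occupancy, subtreeSum]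
  obtain ⟨m, hm, hmc⟩ := hS c
  have h4 := h3 ⟨m, hm, hmc ▸ T.mem_descendants_self _⟩
  rw [h0] at h1 h2 h4
  rw [Nat.even_iff] at h2
  rw [leastCrossings]
  split <;> omega

theorem detour_le (q : ℝ) (v : V) : T.detour q v ≤ 2 * T.subtreeSum T.parentWeight v := by
  induction v using T.child_induction with
  | _ v ih =>
    by_cases h : T.Near q v
    · rw [T.detour_near h]
    · rw [T.detour_not_near h, serve, T.subtreeSum_eq, mul_add, ← List.sum_map_mul_left]
      have h1 := List.sum_le_sum ih
      have h2 := T.parentWeight_nonneg v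
      -- Failure of `Near` says exactly that leaving an agent below `v` is cheaper than crossing the
      -- edge above `v` twice.
      have h3 : max 0 (T.depth v + q - T.height q v) ≤ 2 * T.parentWeight v := by
        rw [Near] at h
        exact max_le (by linarith) (by linarith)
      linarith

theorem detour_le_serve (q : ℝ) (v : V) : T.detour q v ≤ T.serve q v := by
  by_cases h : T.Near q v
  · rw [T.detour_near h, T.serve_of_height_le (T.height_le_of_near h)]
    rw [Near] at h
    linarith
  · rw [T.detour_not_near h]

theorem _root_.List.sum_map_add_le_sum_map {α : Type} [DecidableEq α] {l : List α} {f g : α → ℝ}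
    {a : α} {δ : ℝ} (h : ∀ x ∈ l, f x ≤ g x) (ha : a ∈ l) (h' : f a + δ ≤ g a) :
    (l.map f).sum + δ ≤ (l.map g).sum := by
  have hp := List.perm_cons_erase ha
  have h1 := List.sum_le_sum fun x (hx : x ∈ l.erase a) => h x (List.mem_of_mem_erase hx)
  rw [(hp.map f).sum_eq, (hp.map g).sum_eq, List.map_cons, List.map_cons, List.sum_cons,
    List.sum_cons]
  linarith

/-- Here `depth v + q - parentWeight v` is the price of bringing an agent to the parent of `v`, and
`q` at the root. All that is used about `n` is that the agents below the children of `v` are among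
those below `v`. -/
theorem serve_le {q : ℝ} (hq : 0 ≤ q) {n : V → ℕ}
    (hn : ∀ v, ((T.children v).map n).sum ≤ n v) (v : V) :
    (n v = 0 → T.subtreeSum (fun x => T.parentWeight x * leastCrossings (n x)) v =
      2 * T.subtreeSum T.parentWeight v) ∧
    (1 ≤ n v → T.serve q v ≤ n v * (T.depth v + q - T.parentWeight v) +
      T.subtreeSum (fun x => T.parentWeight x * leastCrossings (n x)) v) := by
  induction v using T.child_induction with
  | _ v ih =>
    set g : V → ℝ := fun x => T.parentWeight x * leastCrossings (n x) with hg
    refine ⟨fun h0 => ?_, fun h1 => ?_⟩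
    · have hc : ∀ u ∈ T.children v, n u = 0 := fun u hu => by
        have h2 := List.le_sum_of_mem (List.mem_map_of_mem (f := n) hu)
        have h3 := hn v
        omega
      rw [T.subtreeSum_eq, T.subtreeSum_eq T.parentWeight,
        List.map_congr_left fun u hu => (ih u hu).1 (hc u hu), List.sum_map_mul_left, mul_add]
      simp [hg, h0, leastCrossings, mul_comm]
    · have hP : 0 ≤ T.depth v + q := add_nonneg (T.depth_nonneg v) hq
      -- Child by child, a detour is at most what the strategy pays: either no agent ends below `u`
      -- and all edges are used twice, or `n u` agents are brought to `v` and `detour` is at most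
      -- `serve`.
      have hbracket : ∀ u ∈ T.children v,
          T.detour q u ≤ n u * (T.depth v + q) + T.subtreeSum g u := by
        intro u hu
        by_cases h0 : n u = 0
        · rw [(ih u hu).1 h0, h0]
          simpa using T.detour_le q u
        · have h2 := (ih u hu).2 (by omega)
          rw [T.depth_child hu, add_right_comm, add_sub_cancel_right] at h2
          exact (T.detour_le_serve q u).trans h2
      have hgv : g v = T.parentWeight v * n v := by
        simp only [hg, leastCrossings]
        rw [if_neg (by omega)]
      have hsum : ((T.children v).map fun u => (n u : ℝ) * (T.depth v + q) +
          T.subtreeSum g u).sum = ((T.children v).map n).sum * (T.depth v + q) +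
          ((T.children v).map (T.subtreeSum g)).sum := by
        rw [List.sum_map_add, List.sum_map_mul_right, Nat.cast_list_sum, List.map_map]
        rfl
      have hnv : (((T.children v).map n).sum : ℝ) ≤ n v := by exact_mod_cast hn v
      have hmul := mul_le_mul_of_nonneg_right hnv hP
      rw [T.subtreeSum_eq g, hgv]
      suffices h : T.serve q v ≤ n v * (T.depth v + q) +
          ((T.children v).map (T.subtreeSum g)).sum by linarith
      rw [serve]
      by_cases hh : T.height q v ≤ T.depth v + q
      · rw [max_eq_right (by linarith)]
        -- It remains to pay for `depth v + q - height v`. If some child `u` keeps an agent, then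
        -- `u` is near and `serve q u` exceeds `detour q u` by at least this amount, because no
        -- child reaches deeper than `height v`.
        by_cases hex : ∃ u ∈ T.children v, n u ≠ 0
        · obtain ⟨u, hu, hu0⟩ := hex
          have h2 := (ih u hu).2 (by omega)
          have hnear := T.near_child hh hu
          obtain ⟨-, -, -, -, -, hmax⟩ := T.label_uc q (List.ne_nil_of_mem hu)
          have h3 := hmax u hu
          rw [T.serve_of_height_le (T.height_le_of_near hnear), ← T.detour_near hnear,
            T.depth_child hu, add_right_comm, add_sub_cancel_right] at h2
          have h4 := List.sum_map_add_le_sum_map hbracket hu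
            (δ := T.depth v + q - T.height q v) (by linarith)
          linarith
        · push Not at hex
          have h2 := List.sum_le_sum hbracket
          have h0 : ((T.children v).map n).sum = 0 := by
            rw [List.map_congr_left hex]
            simp
          rw [hsum, h0] at h2
          -- No agent ends below a child, so at least one ends at `v` itself; its price `depth v +
          -- q` covers the missing term.
          have h3 := T.height_nonneg q v
          have h4 : T.depth v + q ≤ n v * (T.depth v + q) :=
            le_mul_of_one_le_left hP (by exact_mod_cast h1)
          simp only [Nat.cast_zero, zero_mul, zero_add] at h2
          linarith
      · rw [max_eq_left (by linarith)]
        have h2 := List.sum_le_sum hbracket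
        linarith

theorem length_foldl_after (pos : List V) (S : List (Move V)) :
    (S.foldl T.after pos).length = pos.length + numAgents S := by
  induction S generalizing pos with
  | nil => simp
  | cons m S ih =>
    rw [List.foldl_cons, ih]
    cases m <;> simp [after, numAgents, Move.invocations, add_assoc]

theorem one_le_numAgents {S : List (Move V)} (h : T.IsStrategy S) (hS : T.Explores S) :
    1 ≤ numAgents S := by
  obtain ⟨m, hm, -⟩ := hS T.root
  cases S with
  | nil => simp at hm
  | cons m S =>
    cases m with
    | invoke => simp [numAgents, Move.invocations]
    | traverse i u v => simpa using h.1.1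

theorem serve_root_le_cost {q : ℝ} (hq : 0 ≤ q) {S : List (Move V)} (h : T.IsStrategy S)
    (hS : T.Explores S) : T.serve q T.root ≤ T.cost q S := by
  have hlen : T.occupancy T.root (S.foldl T.after []) = numAgents S := by
    rw [occupancy_root, length_foldl_after]
    simp
  have h1 := (T.serve_le hq (n := fun v => T.occupancy v (S.foldl T.after [])) (fun v => by
    rw [occupancy, T.subtreeSum_eq]
    exact Nat.le_add_left _ _) T.root).2 (hlen ▸ T.one_le_numAgents h hS)
  rw [hlen, T.depth_root, T.parentWeight_root, subtreeSum_root, zero_add, sub_zero] at h1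
  rw [T.cost_eq q h, T.travel_eq_sum h]
  refine h1.trans (add_le_add_right (Finset.sum_le_sum fun c _ => ?_) _)
  by_cases hc : c = T.root
  · simp [hc, T.parentWeight_root]
  · exact mul_le_mul_of_nonneg_left (by exact_mod_cast T.leastCrossings_le h hS hc)
      (T.parentWeight_nonneg c)

end WeightedTree

/-! ### The main theorem. -/

theorem mainTheorem1 :
    ∃ C : ℕ, ∀ (V : Type) [Fintype V] [DecidableEq V] (T : WeightedTree V) (q : ℝ),
      2 ≤ Fintype.card V → 0 ≤ q →
        (∃ S : List (Move V), T.Expands [] (T.costExpl q).val S) ∧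
        (∀ S : List (Move V), T.Expands [] (T.costExpl q).val S → T.IsCostOptimal q S) ∧
        (T.costExpl q).steps ≤ C * Fintype.card V := by
  refine ⟨49, fun V _ _ T q hcard hq => ?_⟩
  obtain ⟨h1, h2⟩ := WeightedTree.carries_program_root (T := T) hq hcard
  rw [T.val_costExpl]
  refine ⟨h1, fun S hS => ?_, T.steps_costExpl_le q⟩
  obtain ⟨hleg, hn, ht, hex⟩ := h2 S hS
  refine ⟨hleg, hex, fun S' hS' hex' => ?_⟩
  rw [T.cost_eq q hleg, hn, ht, add_sub_cancel]
  exact T.serve_root_le_cost hq hS' hex'
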